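/- Notation. For an open subset $U$ of $\mathbb{R}^m$ let $\mathcal{E}_M(U)$ be the set of nets $(u_\varepsilon)_{\varepsilon\in(0,1)}$ of smooth complex-valued functions on $U$ such that for every compact $K\subset U$ and every order $n$ there is $a\in\mathbb{R}$ such that all partial derivatives of order $n$ of $u_\varepsilon$ are $O(\varepsilon^{a})$ uniformly on $K$ as $\varepsilon\to 0$ (moderate nets), and let $\mathcal{N}(U)$ be the set of those nets for which this holds for every $a\in\mathbb{R}$ (null nets). Let $\mathcal{G}(U)=\mathcal{E}_M(U)/\mathcal{N}(U)$; a representative of $f\in\mathcal{G}(U)$ is a moderate net with class $f$. For open $\Omega\subset\mathbb{C}^d$, $\mathcal{E}_M(\Omega)$ is defined through $\mathbb{C}^d\cong\mathbb{R}^{2d}$. For $\omega\subset\mathbb{R}^d$ open, $\mathcal{G}_A(\omega)$ is the set of all $f\in\mathcal{G}(\omega)$ which are real analytic at every $x_0\in\omega$, that is: there are an open ball $B=B(x_0,r)\subset\omega$, a representative $(g_\varepsilon)_\varepsilon\in\mathcal{E}_M(B)$ of $f|_B$, and $\eta>0$, $a>0$, $\varepsilon_0\in(0,1)$ such that $$\sup_{x\in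 B}|g_\varepsilon^{(\alpha)}(x)|\le \eta^{|\alpha|+1}\,\alpha!\,\varepsilon^{-a},\qquad 0<\varepsilon<\varepsilon_0,\ \alpha\in\mathbb{N}_0^d .$$ Corollary 1. (a) Let $\omega\subset\mathbb{R}^d$ be open, let $f\in\mathcal{G}_A(\omega)$, and let $\omega_1$ be an open set whose closure is compact and contained in $\omega$. Then there are an open set $\Omega_1\subset\mathbb{C}^d$ with $\Omega_1\cap\mathbb{R}^d=\omega_1$ and a net $(F_\varepsilon)_{\varepsilon\in(0,1)}\in\mathcal{E}_M(\Omega_1)$ of holomorphic functions on $\Omega_1$ such that $(F_\varepsilon|_{\omega_1})_\varepsilon$ is a representative of $f|_{\omega_1}$. (b) Let $\omega\subset\mathbb{R}$ be open and let $f\in\mathcal{G}_A(\omega)$. Then there are an open set $\Omega\subset\mathbb{C}$ with $\Omega\cap\mathbb{R}=\omega$ and a net $(F_\varepsilon)_{\varepsilon\in(0,1)}\in\mathcal{E}_M(\Omega)$ of holomorphic functions on $\Omega$ such that $(F_\varepsilon|_{\omega})_\varepsilon$ is a representative of $f$. -/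

import Mathlib

open Set Metric

section Nets

variable {E : Type*} [NormedAddCommGroup E] [NormedSpace ℝ E]

/-- Nets `(u_ε)`, `ε ∈ (0,1)`, of complex-valued functions. As usual a function on an open set `ω`
is a total function of which only the values on `ω` matter. -/
abbrev Net (E : Type*) : Type _ := Ioo (0 : ℝ) 1 → E → ℂ

/-- All derivatives of order `n` of the net are `O(ε ^ a)` as `ε → 0`, uniformly on `K`.
(In finite dimension the norm of the full `n`-th derivative is comparable with the largest partial
derivative of order `n`.) -/
def Net.DerivIsBigO (u : Net E) (K : Set E) (n : ℕ) (a : ℝ) : Prop :=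
  ∃ C : ℝ, ∃ ε₀ ∈ Ioo (0 : ℝ) 1, ∀ ε : Ioo (0 : ℝ) 1, (ε : ℝ) < ε₀ →
    ∀ x ∈ K, ‖iteratedFDeriv ℝ n (u ε) x‖ ≤ C * (ε : ℝ) ^ a

/-- The net consists of smooth functions on `ω`. -/
def Net.IsSmoothOn (ω : Set E) (u : Net E) : Prop :=
  ∀ ε, ContDiffOn ℝ ((⊤ : ℕ∞) : WithTop ℕ∞) (u ε) ω

/-- The moderate nets `𝓔_M(ω)`, for `ω` open. -/
def Net.IsModerateOn (ω : Set E) (u : Net E) : Prop :=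
  u.IsSmoothOn ω ∧ ∀ K ⊆ ω, IsCompact K → ∀ n : ℕ, ∃ a : ℝ, u.DerivIsBigO K n a

/-- The null nets `𝓝(ω)`, for `ω` open. -/
def Net.IsNullOn (ω : Set E) (u : Net E) : Prop :=
  u.IsSmoothOn ω ∧ ∀ K ⊆ ω, IsCompact K → ∀ n : ℕ, ∀ b : ℝ, u.DerivIsBigO K n b

end Nets

section Algebra

variable {E : Type*} [NormedAddCommGroup E] [NormedSpace ℝ E]

theorem Net.IsModerateOn.mono {ω ω' : Set E} (h : ω' ⊆ ω) {u : Net E} (hu : u.IsModerateOn ω) :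
    u.IsModerateOn ω' :=
  ⟨fun ε => (hu.1 ε).mono h, fun K hK => hu.2 K (hK.trans h)⟩

theorem Net.IsNullOn.mono {ω ω' : Set E} (h : ω' ⊆ ω) {u : Net E} (hu : u.IsNullOn ω) :
    u.IsNullOn ω' :=
  ⟨fun ε => (hu.1 ε).mono h, fun K hK => hu.2 K (hK.trans h)⟩

theorem Net.isNullOn_zero (ω : Set E) : (0 : Net E).IsNullOn ω := by
  refine ⟨fun ε => contDiffOn_const, fun K _ _ n b => ⟨0, 1 / 2, by norm_num, ?_⟩⟩
  intro ε _ x _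
  simp

theorem Net.IsNullOn.neg {ω : Set E} {u : Net E} (hu : u.IsNullOn ω) : (-u).IsNullOn ω := by
  refine ⟨fun ε => (hu.1 ε).neg, fun K hK hc n b => ?_⟩
  obtain ⟨C, ε₀, h₀, h⟩ := hu.2 K hK hc n b
  refine ⟨C, ε₀, h₀, fun ε hε x hx => ?_⟩
  have : (-u) ε = -(u ε) := rfl
  rw [this, iteratedFDeriv_neg_apply, norm_neg]
  exact h ε hε x hx

theorem Net.IsNullOn.add {ω : Set E} (hω : IsOpen ω) {u v : Net E} (hu : u.IsNullOn ω)
    (hv : v.IsNullOn ω) : (u + v).IsNullOn ω := by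
  refine ⟨fun ε => (hu.1 ε).add (hv.1 ε), fun K hK hc n b => ?_⟩
  obtain ⟨C, ε₀, h₀, h⟩ := hu.2 K hK hc n b
  obtain ⟨C', ε₁, h₁, h'⟩ := hv.2 K hK hc n b
  refine ⟨C + C', min ε₀ ε₁, ⟨lt_min h₀.1 h₁.1, (min_le_left _ _).trans_lt h₀.2⟩,
    fun ε hε x hx => ?_⟩
  have hs : ∀ {w : Net E}, w.IsNullOn ω → ContDiffAt ℝ n (w ε) x := fun hw =>
    ((hw.1 ε).contDiffAt (hω.mem_nhds (hK hx))).of_le (by exact_mod_cast le_top)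
  have : (u + v) ε = u ε + v ε := rfl
  rw [this, iteratedFDeriv_add_apply (hs hu) (hs hv), add_mul]
  exact (norm_add_le _ _).trans (add_le_add (h ε (hε.trans_le (min_le_left _ _)) x hx)
    (h' ε (hε.trans_le (min_le_right _ _)) x hx))

/-- Two moderate nets on the open set `ω` are equivalent if their difference is a null net. -/
def colombeauSetoid (ω : TopologicalSpace.Opens E) :
    Setoid {u : Net E // u.IsModerateOn (ω : Set E)} where
  r u v := (u.1 - v.1).IsNullOn (ω : Set E)
  iseqv :=
    { refl := fun u => by
        rw [sub_self]
        exact Net.isNullOn_zero _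
      symm := fun {u v} h => by
        rw [← neg_sub]
        exact h.neg
      trans := fun {u v w} h h' => by
        rw [← sub_add_sub_cancel u.1 v.1 w.1]
        exact h.add ω.isOpen h' }

/-- The simplified Colombeau algebra `𝓖(ω) = 𝓔_M(ω) / 𝓝(ω)` (as a set). -/
def Colombeau (ω : TopologicalSpace.Opens E) : Type _ := Quotient (colombeauSetoid ω)

/-- The class `[(u_ε)]` of a moderate net. -/
def Colombeau.mk {ω : TopologicalSpace.Opens E} (u : Net E) (hu : u.IsModerateOn (ω : Set E)) :
    Colombeau ω :=
  Quotient.mk (colombeauSetoid ω) ⟨u, hu⟩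

/-- Restriction of a generalized function to a smaller open set. -/
def Colombeau.restrict {ω ω' : TopologicalSpace.Opens E} (h : ω' ≤ ω) :
    Colombeau ω → Colombeau ω' :=
  Quotient.map' (s₁ := colombeauSetoid ω) (s₂ := colombeauSetoid ω')
    (fun u => ⟨u.1, u.2.mono h⟩) (fun _ _ huv => Net.IsNullOn.mono h huv)

/-- The net `(u_ε)` is moderate on `ω` and represents the generalized function `f`. -/
def Colombeau.IsRepresentative {ω : TopologicalSpace.Opens E} (f : Colombeau ω) (u : Net E) :
    Prop :=
  ∃ hu : u.IsModerateOn (ω : Set E), f = Colombeau.mk u hu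

end Algebra

section RealAnalytic

variable {d : ℕ}

/-- The partial derivative `∂_{i 0} ∂_{i 1} ⋯ ∂_{i (n-1)} g (x)`. For smooth `g` this is
`g^(α)(x)` with `α = multiIndex i`, and every multi-index `α` with `|α| = n` is of this form. -/
noncomputable def partialDeriv (g : EuclideanSpace ℝ (Fin d) → ℂ) {n : ℕ} (i : Fin n → Fin d)
    (x : EuclideanSpace ℝ (Fin d)) : ℂ :=
  iteratedFDeriv ℝ n g x (fun k => EuclideanSpace.single (i k) (1 : ℝ))

/-- The multi-index `α` of a sequence of directions: `α j` counts how often `j` occurs. -/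
def multiIndex {n : ℕ} (i : Fin n → Fin d) : Fin d → ℕ :=
  fun j => (Finset.univ.filter (fun k => i k = j)).card

/-- `f ∈ 𝓖(ω)` is real analytic at `x₀`: on some ball `B = B(x₀, r) ⊆ ω` it has a representative
`(g_ε)` with `sup_B |g_ε^(α)| ≤ η ^ (|α| + 1) α! ε ^ (-a)` for all `α` and all small `ε`. -/
def Colombeau.RealAnalyticAt {ω : TopologicalSpace.Opens (EuclideanSpace ℝ (Fin d))}
    (f : Colombeau ω) (x₀ : EuclideanSpace ℝ (Fin d)) : Prop :=
  ∃ r : ℝ, 0 < r ∧ ∃ B : TopologicalSpace.Opens (EuclideanSpace ℝ (Fin d)),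
    (B : Set (EuclideanSpace ℝ (Fin d))) = ball x₀ r ∧ ∃ hB : B ≤ ω,
    ∃ g : Net (EuclideanSpace ℝ (Fin d)), (f.restrict hB).IsRepresentative g ∧
      ∃ η : ℝ, 0 < η ∧ ∃ a : ℝ, 0 < a ∧ ∃ ε₀ ∈ Ioo (0 : ℝ) 1,
        ∀ ε : Ioo (0 : ℝ) 1, (ε : ℝ) < ε₀ → ∀ (n : ℕ) (i : Fin n → Fin d), ∀ x ∈ B,
          ‖partialDeriv (g ε) i x‖ ≤
            η ^ (n + 1) * (∏ j, ((multiIndex i j).factorial : ℝ)) * (ε : ℝ) ^ (-a)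

/-- `f ∈ 𝓖_A(ω)`. -/
def Colombeau.IsRealAnalytic {ω : TopologicalSpace.Opens (EuclideanSpace ℝ (Fin d))}
    (f : Colombeau ω) : Prop :=
  ∀ x₀ ∈ ω, f.RealAnalyticAt x₀

/-- The inclusion `ℝ^d ⊆ ℂ^d`. -/
noncomputable def realToComplex (x : EuclideanSpace ℝ (Fin d)) : EuclideanSpace ℂ (Fin d) :=
  WithLp.toLp 2 (fun j => (x j : ℂ))

end RealAnalytic

/-! Gluing local holomorphic extensions is avoided: for each ε one entire function is built from a
representative `u`, and it is close to all the local power series at once. Write L = log (1/ε). Near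
each point x of ω, `u` differs by a null net from a net `g` whose complexified Taylor series has
terms bounded by η ε^(-a) κ^n, so its sum is holomorphic on a complex ball that does not depend on
ε. It suffices to find entire functions F whose distance to these sums is O(ε^b) for every b on
small complex balls covering ω: Cauchy's estimates then make F moderate near ω and u - F null on ω
(`IsLocalExpansion.derivIsBigO`).

F is a convolution of `u`, cut off to a compact set, with Gaussians of width about s = 1/(A√L). A
single Gaussian has an error of order s², which is only logarithmic in ε. Instead about A·L
Gaussians with widths in [s, 2s] are combined with Lagrange weights that extrapolate to width zero
(`exists_extrapolation`). With D of order A·L the weights cost exp(4D), but on the Taylor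
polynomials of degree below N, of order 1/s², the extrapolation error is still O(ε^(-a) exp(-D))
(`IsExtrapolation.norm_sub_partialSum_le`). With T = 1/s² = A²L, the integral beyond radius ρ gains
exp(-ρ²T/16), truncating the series gains 2^(-N), and moving to a complex point w costs exp(πT‖w‖²).
For small w and large A the gains beat all the costs, and the total error is O(ε^b) once A exceeds a
threshold depending on b (`exists_norm_gaussRegularization_sub_sum_le`).

The radius allowed for w depends neither on A nor on b. Hence A may tend to infinity as ε → 0,
slowly enough for the moderateness and nullity estimates on growing compact sets to stay valid; the
diagonal choice is `exists_tendsto_atTop_eventually`. The result is global in every dimension, and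
both parts of the corollary follow from it. -/

open MeasureTheory Filter Topology

/-! ### Holomorphic functions of several variables: parameter integrals and Cauchy estimates. -/

section Holomorphic

universe u

variable {V W : Type u} [NormedAddCommGroup V] [NormedSpace ℂ V] [NormedAddCommGroup W]
  [NormedSpace ℂ W]

/-- **Cauchy's estimate** for the Fréchet derivative. -/
theorem norm_fderiv_le_of_norm_le {f : V → W} {z : V} {R M : ℝ} (hR : 0 < R)
    (hf : DifferentiableOn ℂ f (ball z R)) (hM : ∀ y ∈ ball z R, ‖f y‖ ≤ M) :
    ‖fderiv ℂ f z‖ ≤ 2 * M / R := by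
  refine Complex.norm_fderiv_le_div_of_mapsTo_ball hf (fun y hy => ?_) hR
  rw [mem_closedBall, dist_eq_norm]
  linarith [norm_sub_le (f y) (f z), hM y hy, hM z (mem_ball_self hR)]

variable [FiniteDimensional ℂ V]

/-- On a finite-dimensional space an operator is a fixed finite combination of its values on a
basis, so measurability can be tested on vectors. -/
theorem aestronglyMeasurable_of_forall_apply {α : Type*} [MeasurableSpace α] {μ : Measure α}
    {L : α → V →L[ℂ] W} (h : ∀ v, AEStronglyMeasurable (fun a => L a v) μ) :
    AEStronglyMeasurable L μ := by
  let b := Module.finBasis ℂ V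
  have : L = fun a => ∑ i, ContinuousLinearMap.smulRightL ℂ V W
      (LinearMap.toContinuousLinearMap (b.coord i)) (L a (b i)) := by
    ext a v
    simp only [_root_.sum_apply]
    conv_lhs => rw [← b.sum_repr v, map_sum]
    simp
  rw [this]
  exact Finset.aestronglyMeasurable_fun_sum _ fun i _ =>
    (ContinuousLinearMap.continuous _).comp_aestronglyMeasurable (h _)

/-- An integral which depends holomorphically on a parameter, with locally dominated integrand. -/
theorem differentiableAt_integral_of_dominated [CompleteSpace W] {α : Type*} [MeasurableSpace α]
    {μ : Measure α} {Φ : V → α → W} {z₀ : V} {R : ℝ} (hR : 0 < R) {bound : α → ℝ}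
    (hb : Integrable bound μ) (hm : ∀ z ∈ ball z₀ R, AEStronglyMeasurable (Φ z) μ)
    (hd : ∀ a, DifferentiableOn ℂ (fun z => Φ z a) (ball z₀ R))
    (hle : ∀ z ∈ ball z₀ R, ∀ a, ‖Φ z a‖ ≤ bound a) :
    DifferentiableAt ℂ (fun z => ∫ a, Φ z a ∂μ) z₀ := by
  have hR2 : 0 < R / 2 := half_pos hR
  have hsub : ∀ z ∈ ball z₀ (R / 2), ball z (R / 2) ⊆ ball z₀ R := fun z hz y hy => by
    rw [mem_ball] at *
    linarith [dist_triangle y z z₀]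
  have hdiff : ∀ z ∈ ball z₀ R, ∀ a, HasFDerivAt (fun z => Φ z a)
      (fderiv ℂ (fun z => Φ z a) z) z := fun z hz a =>
    ((hd a).differentiableAt (isOpen_ball.mem_nhds hz)).hasFDerivAt
  have hz₀ : z₀ ∈ ball z₀ R := mem_ball_self hR
  -- In each direction the derivative is a pointwise limit of difference quotients along a sequence,
  -- and these are measurable in `a`.
  have hmeas : AEStronglyMeasurable (fun a => fderiv ℂ (fun z => Φ z a) z₀) μ := by
    refine aestronglyMeasurable_of_forall_apply fun v => ?_
    obtain ⟨t, ht0, ht, hlt⟩ : ∃ t : ℕ → ℂ, (∀ n, t n ≠ 0) ∧ Tendsto t atTop (𝓝 0) ∧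
        ∀ n, z₀ + t n • v ∈ ball z₀ R := by
      have hc : Tendsto (fun t : ℂ => z₀ + t • v) (𝓝[≠] 0) (𝓝 z₀) := by
        have : Continuous fun t : ℂ => z₀ + t • v := by fun_prop
        simpa using (this.tendsto 0).mono_left nhdsWithin_le_nhds
      have hev := (hc.eventually (isOpen_ball.mem_nhds hz₀)).and self_mem_nhdsWithin
      obtain ⟨t, ht, h⟩ := exists_seq_forall_of_frequently hev.frequently
      exact ⟨t, fun n => (h n).2, ht.mono_right nhdsWithin_le_nhds, fun n => (h n).1⟩
    refine aestronglyMeasurable_of_tendsto_ae atTop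
      (f := fun n a => (t n)⁻¹ • (Φ (z₀ + t n • v) a - Φ z₀ a))
      (fun n => ((hm _ (hlt n)).sub (hm _ hz₀)).const_smul _) (ae_of_all _ fun a => ?_)
    have h1 : HasDerivAt (fun s : ℂ => Φ (z₀ + s • v) a)
        (fderiv ℂ (fun z => Φ z a) z₀ v) 0 := by
      have h2 : HasDerivAt (fun s : ℂ => z₀ + s • v) v 0 := by
        simpa using ((hasDerivAt_id (0 : ℂ)).smul_const v).const_add z₀
      have h3 := hdiff z₀ hz₀ a
      have h4 : z₀ = z₀ + (0 : ℂ) • v := by simp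
      exact HasFDerivAt.comp_hasDerivAt (0 : ℂ) (by rw [← h4]; exact h3) h2
    have h5 := h1.tendsto_slope_zero
    have h6 := h5.comp (tendsto_nhdsWithin_iff.2 ⟨ht, Eventually.of_forall ht0⟩)
    simpa [Function.comp_def] using h6
  refine (hasFDerivAt_integral_of_dominated_of_fderiv_le (𝕜 := ℂ) (ball_mem_nhds z₀ hR2)
    (bound := fun a => 2 * bound a / (R / 2))
    (F' := fun z a => fderiv ℂ (fun z => Φ z a) z) ?_ ?_ hmeas ?_ ?_ ?_).differentiableAt
  · filter_upwards [ball_mem_nhds z₀ hR] with z hz using hm z hz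
  · exact hb.mono' (hm z₀ hz₀) (ae_of_all _ (hle z₀ hz₀))
  · exact ae_of_all _ fun a z hz => norm_fderiv_le_of_norm_le hR2 ((hd a).mono (hsub z hz))
      fun y hy => hle y (hsub z hz hy) a
  · exact (hb.const_mul 2).div_const _
  · exact ae_of_all _ fun a z hz => hdiff z (ball_subset_ball (by linarith) hz) a

/-- The derivative of a holomorphic function of several variables is holomorphic. -/
theorem DifferentiableOn.fderiv_of_isOpen_complex [CompleteSpace W] {f : V → W} {U : Set V}
    (hU : IsOpen U) (hf : DifferentiableOn ℂ f U) : DifferentiableOn ℂ (fderiv ℂ f) U := by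
  intro z₀ hz₀
  suffices h : ∀ v, DifferentiableAt ℂ (fun z => fderiv ℂ f z v) z₀ by
    let b := Module.finBasis ℂ V
    have : fderiv ℂ f = fun z => ∑ i, ContinuousLinearMap.smulRightL ℂ V W
        (LinearMap.toContinuousLinearMap (b.coord i)) (fderiv ℂ f z (b i)) := by
      ext z v
      simp only [_root_.sum_apply]
      conv_lhs => rw [← b.sum_repr v, map_sum]
      simp
    rw [this]
    exact (DifferentiableAt.fun_sum fun i _ =>
      (ContinuousLinearMap.differentiableAt _).comp z₀ (h (b i))).differentiableWithinAt
  intro v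
  have hc : ContinuousAt f z₀ := (hf.differentiableAt (hU.mem_nhds hz₀)).continuousAt
  obtain ⟨r, hr, hball⟩ : ∃ r > 0, ball z₀ r ⊆ U ∩ {z | ‖f z‖ < ‖f z₀‖ + 1} :=
    Metric.mem_nhds_iff.1 (inter_mem (hU.mem_nhds hz₀)
      (hc.norm.eventually_lt continuousAt_const (lt_add_one _)))
  -- The circle of radius s in direction v moves points by at most r / 2; the summand 1 covers v =
  -- 0.
  set s : ℝ := r / 2 / (‖v‖ + 1) with hs
  have hv : 0 < ‖v‖ + 1 := by positivity
  have hs0 : 0 < s := by positivity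
  have hsv : s * ‖v‖ ≤ r / 2 := by
    rw [hs, div_mul_eq_mul_div, div_le_iff₀ hv]
    nlinarith [norm_nonneg v]
  have hmem : ∀ z ∈ ball z₀ (r / 2), ∀ ζ ∈ closedBall (0 : ℂ) s, z + ζ • v ∈ ball z₀ r := by
    intro z hz ζ hζ
    rw [mem_ball, dist_eq_norm] at *
    rw [mem_closedBall, dist_zero_right] at hζ
    calc ‖z + ζ • v - z₀‖ = ‖(z - z₀) + ζ • v‖ := by congr 1; abel
      _ ≤ ‖z - z₀‖ + ‖ζ‖ * ‖v‖ := (norm_add_le _ _).trans (by rw [norm_smul])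
      _ < r / 2 + r / 2 := by
        have := mul_le_mul_of_nonneg_right hζ (norm_nonneg v)
        linarith
      _ = r := by ring
  have hlin : ∀ z : V, Differentiable ℂ fun ζ : ℂ => z + ζ • v := fun z => by fun_prop
  -- Cauchy's formula on the complex line through z in direction v turns the derivative into an
  -- integral depending holomorphically on z.
  have key : ∀ z ∈ ball z₀ (r / 2), fderiv ℂ f z v =
      (2 * Real.pi * Complex.I : ℂ)⁻¹ • ∮ ζ in C(0, s), ((ζ - 0) ^ 2)⁻¹ • f (z + ζ • v) := by
    intro z hz
    have hopen : IsOpen ((fun ζ : ℂ => z + ζ • v) ⁻¹' ball z₀ r) :=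
      isOpen_ball.preimage (hlin z).continuous
    have h1 := Complex.cderiv_eq_deriv hopen (f := fun ζ : ℂ => f (z + ζ • v)) (z := 0)
      ((hf.mono (hball.trans inter_subset_left)).comp (hlin z).differentiableOn
        (mapsTo_preimage _ _)) hs0 (fun ζ hζ => hmem z hz ζ hζ)
    rw [← Complex.cderiv, h1]
    have h2 : HasDerivAt (fun ζ : ℂ => z + ζ • v) v 0 := by
      simpa using ((hasDerivAt_id (0 : ℂ)).smul_const v).const_add z
    have hzU : z ∈ U := (hball (ball_subset_ball (by linarith) hz)).1
    have h3 := (hf.differentiableAt (hU.mem_nhds hzU)).hasFDerivAt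
    have h4 : z = z + (0 : ℂ) • v := by simp
    exact (HasFDerivAt.comp_hasDerivAt (0 : ℂ) (by rw [← h4]; exact h3) h2).deriv.symm
  have hgoal : DifferentiableAt ℂ (fun z => (2 * Real.pi * Complex.I : ℂ)⁻¹ •
      ∮ ζ in C(0, s), ((ζ - 0) ^ 2)⁻¹ • f (z + ζ • v)) z₀ := by
    refine DifferentiableAt.const_smul ?_ _
    simp only [circleIntegral, intervalIntegral.integral_of_le Real.two_pi_pos.le]
    have hcm : ∀ θ, circleMap 0 s θ ∈ closedBall (0 : ℂ) s := fun θ =>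
      circleMap_mem_closedBall 0 hs0.le θ
    refine differentiableAt_integral_of_dominated (half_pos hr)
      (bound := fun _ => s * (s ^ 2)⁻¹ * (‖f z₀‖ + 1)) (integrable_const _) ?_ ?_ ?_
    · intro z hz
      have hfc : Continuous fun θ => f (z + circleMap 0 s θ • v) :=
        (hf.continuousOn.mono (hball.trans inter_subset_left)).comp_continuous
          (by fun_prop) fun θ => hmem z hz _ (hcm θ)
      have hne : ∀ θ, (circleMap 0 s θ - 0) ^ 2 ≠ 0 := fun θ => by
        rw [sub_zero]
        exact pow_ne_zero _ (by simpa using circleMap_ne_center (c := 0) (θ := θ) hs0.ne')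
      have : Continuous fun θ => _root_.deriv (circleMap 0 s) θ • ((circleMap 0 s θ - 0) ^ 2)⁻¹ •
          f (z + circleMap 0 s θ • v) := by
        simp only [deriv_circleMap]
        refine Continuous.smul (by fun_prop) ?_
        exact Continuous.smul (Continuous.inv₀ (by fun_prop) hne) hfc
      exact this.aestronglyMeasurable
    · intro θ
      refine DifferentiableOn.const_smul (DifferentiableOn.const_smul ?_ _) _
      exact (hf.mono (hball.trans inter_subset_left)).comp
        (Differentiable.differentiableOn (by fun_prop)) fun z hz => hmem z hz _ (hcm θ)
    · intro z hz θ
      have h1 := (hball (hmem z hz _ (hcm θ))).2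
      change ‖f _‖ < _ at h1
      rw [norm_smul, norm_smul, deriv_circleMap, ← mul_assoc]
      refine mul_le_mul (le_of_eq ?_) h1.le (norm_nonneg _) (by positivity)
      simp [abs_of_pos hs0]
  refine hgoal.congr_of_eventuallyEq ?_
  filter_upwards [ball_mem_nhds z₀ (half_pos hr)] with z hz using key z hz

/-- Induction on the order, applied to the derivative. The target changes to `V →L[ℂ] W`, which is
why `W` is generalized and shares a universe with `V`. -/
theorem DifferentiableOn.contDiffOn_complex [CompleteSpace W] {f : V → W} {U : Set V}
    (hU : IsOpen U) (hf : DifferentiableOn ℂ f U) (n : ℕ) : ContDiffOn ℂ n f U := by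
  induction n generalizing W with
  | zero => exact contDiffOn_zero.2 hf.continuousOn
  | succ n ih =>
    push_cast
    rw [contDiffOn_succ_iff_fderiv_of_isOpen hU]
    refine ⟨hf, fun h => ?_, ih (hf.fderiv_of_isOpen_complex hU)⟩
    exact absurd h (by exact_mod_cast WithTop.coe_ne_top)

/-- **Cauchy's estimates**, with a crude constant. -/
theorem norm_iteratedFDeriv_le_of_norm_le [CompleteSpace W] (n : ℕ) {f : V → W} {z : V}
    {R M : ℝ} (hR : 0 < R) (hf : DifferentiableOn ℂ f (ball z R))
    (hM : ∀ y ∈ ball z R, ‖f y‖ ≤ M) :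
    ‖iteratedFDeriv ℂ n f z‖ ≤ (2 ^ (n + 1) / R) ^ n * M := by
  induction n generalizing W M R with
  | zero => simpa using hM z (mem_ball_self hR)
  | succ n ih =>
    have hsub : ∀ y ∈ ball z (R / 2), ball y (R / 2) ⊆ ball z R := fun y hy w hw => by
      rw [mem_ball] at *
      linarith [dist_triangle w y z]
    have hM0 : 0 ≤ M := (norm_nonneg _).trans (hM z (mem_ball_self hR))
    have := ih (half_pos hR) ((hf.fderiv_of_isOpen_complex isOpen_ball).mono
      (ball_subset_ball (by linarith))) (M := 2 * M / (R / 2)) fun y hy =>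
        norm_fderiv_le_of_norm_le (half_pos hR) (hf.mono (hsub y hy)) fun w hw =>
          hM w (hsub y hy hw)
    rw [norm_iteratedFDeriv_fderiv] at this
    refine this.trans ?_
    have e1 : (2 : ℝ) ^ (n + 1) / (R / 2) = 2 ^ (n + 1 + 1) / R := by field_simp; ring
    have e2 : 2 * M / (R / 2) = 4 / R * M := by field_simp; ring
    rw [e1, e2, pow_succ (2 ^ (n + 1 + 1) / R) n, mul_assoc]
    gcongr
    calc (4 : ℝ) = 2 ^ 2 := by norm_num
      _ ≤ 2 ^ (n + 1 + 1) := pow_le_pow_right₀ (by norm_num) (by omega)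

/-- Restricting scalars does not alter the norm of a multilinear map. This transfers complex Cauchy
estimates to the real derivatives that define moderate nets. -/
theorem iteratedFDeriv_real_norm_eq [CompleteSpace W] (n : ℕ) {f : V → W} {U : Set V}
    (hU : IsOpen U) (hf : DifferentiableOn ℂ f U) {z : V} (hz : z ∈ U) :
    ‖iteratedFDeriv ℝ n f z‖ = ‖iteratedFDeriv ℂ n f z‖ := by
  have hc := (hf.contDiffOn_complex hU n).contDiffAt (hU.mem_nhds hz)
  have h := hc.restrictScalars_iteratedFDeriv (𝕜 := ℝ)
  rw [← h]
  simp

theorem norm_iteratedFDeriv_real_le_of_norm_le [CompleteSpace W] (n : ℕ) {f : V → W} {z : V}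
    {R M : ℝ} (hR : 0 < R) (hf : DifferentiableOn ℂ f (ball z R))
    (hM : ∀ y ∈ ball z R, ‖f y‖ ≤ M) :
    ‖iteratedFDeriv ℝ n f z‖ ≤ (2 ^ (n + 1) / R) ^ n * M := by
  rw [iteratedFDeriv_real_norm_eq n isOpen_ball hf (mem_ball_self hR)]
  exact norm_iteratedFDeriv_le_of_norm_le n hR hf hM

theorem DifferentiableOn.contDiffOn_real [CompleteSpace W] {f : V → W} {U : Set V}
    (hU : IsOpen U) (hf : DifferentiableOn ℂ f U) :
    ContDiffOn ℝ ((⊤ : ℕ∞) : WithTop ℕ∞) f U := by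
  rw [contDiffOn_infty]
  exact fun n => (hf.contDiffOn_complex hU n).restrict_scalars ℝ

end Holomorphic

/-! ### Lagrange extrapolation weights of exponential size. -/

theorem pow_self_le_exp_mul_factorial (n : ℕ) : (n : ℝ) ^ n ≤ Real.exp n * n.factorial := by
  have h := Real.pow_div_factorial_le_exp (n : ℝ) (Nat.cast_nonneg n) n
  rwa [div_le_iff₀ (by positivity)] at h

theorem prod_erase_abs_sub (n j : ℕ) (hj : j ≤ n) :
    ∏ i ∈ (Finset.range (n + 1)).erase j, |(i : ℝ) - j| = j.factorial * (n - j).factorial := by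
  have hsplit : (Finset.range (n + 1)).erase j = Finset.range j ∪ Finset.Ico (j + 1) (n + 1) := by
    ext i; simp; omega
  have hdisj : Disjoint (Finset.range j) (Finset.Ico (j + 1) (n + 1)) := by
    rw [Finset.disjoint_left]; intro i; simp; omega
  rw [hsplit, Finset.prod_union hdisj]
  congr 1
  · rw [← Finset.prod_range_reflect, ← Finset.prod_range_add_one_eq_factorial]
    push_cast
    refine Finset.prod_congr rfl fun i hi => ?_
    have : i < j := Finset.mem_range.1 hi
    rw [show j - 1 - i = j - (i + 1) by omega, Nat.cast_sub (by omega), abs_sub_comm,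
      abs_of_nonneg] <;> push_cast <;> linarith [show (0 : ℝ) ≤ i from Nat.cast_nonneg i]
  · rw [Finset.prod_Ico_eq_prod_range, show n + 1 - (j + 1) = n - j by omega,
      ← Finset.prod_range_add_one_eq_factorial]
    push_cast
    refine Finset.prod_congr rfl fun i _ => ?_
    rw [abs_of_nonneg] <;> linarith [show (0 : ℝ) ≤ i from Nat.cast_nonneg i]

/-- Extrapolation to `0` from nodes in `[1, 2]`, exact in degree at most `n`, with weights of
exponential size. -/
theorem exists_extrapolation (n : ℕ) : ∃ v c : ℕ → ℝ, (∀ j ∈ Finset.range (n + 1), v j ∈ Icc 1 2) ∧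
    (∑ j ∈ Finset.range (n + 1), c j = 1) ∧
    (∀ k, 1 ≤ k → k ≤ n → ∑ j ∈ Finset.range (n + 1), c j * v j ^ k = 0) ∧
    ∑ j ∈ Finset.range (n + 1), |c j| ≤ Real.exp (4 * n) := by
  rcases Nat.eq_zero_or_pos n with rfl | hn
  · exact ⟨fun _ => 1, fun _ => 1, by simp, by simp, fun k h1 h2 => by omega, by simp⟩
  have hn' : (0 : ℝ) < n := by exact_mod_cast hn
  let v : ℕ → ℝ := fun j => 1 + j / n
  have hv : ∀ i j, v i - v j = (i - j) / n := fun i j => by simp only [v]; ring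
  have hinj : Set.InjOn v (Finset.range (n + 1) : Set ℕ) := by
    intro i _ j _ h
    have : ((i : ℝ) - j) / n = 0 := by rw [← hv, h, sub_self]
    rw [div_eq_zero_iff, or_iff_left hn'.ne', sub_eq_zero] at this
    exact_mod_cast this
  have hv2 : ∀ j ∈ Finset.range (n + 1), v j ∈ Icc (1 : ℝ) 2 := fun j hj => by
    have hj' : (j : ℝ) ≤ n := by exact_mod_cast Nat.lt_succ_iff.1 (Finset.mem_range.1 hj)
    have h0 : 0 ≤ (j : ℝ) / n := by positivity
    have h1 : (j : ℝ) / n ≤ 1 := (div_le_one hn').2 hj'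
    constructor <;> simp only [v] <;> linarith
  -- Values at 0 of the Lagrange basis: exactness of interpolation on X ^ k for k ≤ n is the family
  -- of moment conditions.
  let c : ℕ → ℝ := fun j => (Lagrange.basis (Finset.range (n + 1)) v j).eval 0
  have hpow : ∀ k ≤ n, ∑ j ∈ Finset.range (n + 1), c j * v j ^ k = (0 : ℝ) ^ k := by
    intro k hk
    have hdeg : (Polynomial.X ^ k : Polynomial ℝ).degree < (Finset.range (n + 1)).card := by
      rw [Polynomial.degree_X_pow, Finset.card_range]
      exact_mod_cast Nat.lt_succ_of_le hk
    have h := Lagrange.eq_interpolate hinj hdeg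
    have h2 := congrArg (Polynomial.eval 0) h
    rw [Lagrange.interpolate_apply, Polynomial.eval_finsetSum] at h2
    simp only [Polynomial.eval_mul, Polynomial.eval_C, Polynomial.eval_pow,
      Polynomial.eval_X] at h2
    rw [h2]
    exact Finset.sum_congr rfl fun j _ => mul_comm _ _
  -- For nodes 1 + j/n the weight is at most (2n)^n / (j! (n-j)!), and n^n ≤ e^n n!. Summing the
  -- binomial coefficients gives (4e)^n, below e^(4n).
  have hc : ∀ j ∈ Finset.range (n + 1), |c j| ≤ n.choose j * (2 * Real.exp 1) ^ n := by
    intro j hj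
    have hj' : j ≤ n := Nat.lt_succ_iff.1 (Finset.mem_range.1 hj)
    have hcard : ((Finset.range (n + 1)).erase j).card = n := by
      rw [Finset.card_erase_of_mem hj, Finset.card_range]; rfl
    have h1 : |c j| ≤ ∏ i ∈ (Finset.range (n + 1)).erase j, (2 * n / |(i : ℝ) - j|) := by
      simp only [c, Lagrange.basis, Polynomial.eval_prod, Finset.abs_prod, Lagrange.basisDivisor]
      refine Finset.prod_le_prod (fun _ _ => abs_nonneg _) fun i hi => ?_
      have hi' := Finset.mem_of_mem_erase hi
      simp only [Polynomial.eval_mul, Polynomial.eval_C, Polynomial.eval_sub, Polynomial.eval_X]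
      rw [hv, abs_mul, abs_inv, abs_div, inv_div, abs_sub_comm (j : ℝ) i, abs_of_pos hn', zero_sub,
        abs_neg, abs_of_nonneg (by linarith [(hv2 i hi').1] : 0 ≤ v i), mul_comm,
        ← mul_div_assoc]
      gcongr
      exact (hv2 i hi').2
    rw [Finset.prod_div_distrib, Finset.prod_const, hcard, prod_erase_abs_sub n j hj'] at h1
    refine h1.trans ?_
    rw [div_le_iff₀ (by positivity), mul_pow, mul_pow, ← Real.exp_nat_mul, mul_one]
    have h2 : (n.choose j : ℝ) * (j.factorial * (n - j).factorial) = n.factorial := by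
      rw [← mul_assoc]; exact_mod_cast Nat.choose_mul_factorial_mul_factorial hj'
    calc (2 : ℝ) ^ n * (n : ℝ) ^ n ≤ 2 ^ n * (Real.exp n * n.factorial) := by
          gcongr; exact pow_self_le_exp_mul_factorial n
      _ = _ := by rw [← h2]; ring
  refine ⟨v, c, hv2, by simpa using hpow 0 (Nat.zero_le _), fun k h1 h2 => ?_, ?_⟩
  · rw [hpow k h2, zero_pow (by omega)]
  · refine (Finset.sum_le_sum hc).trans ?_
    rw [← Finset.sum_mul]
    have : (∑ j ∈ Finset.range (n + 1), (n.choose j : ℝ)) = 2 ^ n := by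
      exact_mod_cast Nat.sum_range_choose n
    rw [this, ← mul_pow, mul_comm 4, Real.exp_nat_mul]
    have h2 : (2 : ℝ) ≤ Real.exp 1 := by linarith [Real.add_one_le_exp (1 : ℝ)]
    refine pow_le_pow_left₀ (by positivity) ?_ n
    have h4 : Real.exp 4 = Real.exp 1 * Real.exp 1 * Real.exp 1 * Real.exp 1 := by
      rw [← Real.exp_add, ← Real.exp_add, ← Real.exp_add]; norm_num
    rw [h4]
    nlinarith [mul_nonneg (sub_nonneg.2 h2) (sub_nonneg.2 h2),
      mul_le_mul h2 h2 (by norm_num) (Real.exp_pos 1).le, Real.exp_pos 1]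

/-! ### Gaussian kernels at complex points. -/

section Gaussian

variable {d : ℕ}

/-- The inclusion `ℝ^d ⊆ ℂ^d` as a linear isometry. -/
noncomputable def realToComplexₗᵢ (d : ℕ) :
    EuclideanSpace ℝ (Fin d) →ₗᵢ[ℝ] EuclideanSpace ℂ (Fin d) where
  toFun := realToComplex
  map_add' x y := by ext i; simp [realToComplex]
  map_smul' c x := by ext i; simp [realToComplex]
  norm_map' x := by simp [realToComplex, EuclideanSpace.norm_eq]

theorem norm_realToComplex (x : EuclideanSpace ℝ (Fin d)) : ‖realToComplex x‖ = ‖x‖ :=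
  (realToComplexₗᵢ d).norm_map x

theorem realToComplex_sub (x y : EuclideanSpace ℝ (Fin d)) :
    realToComplex (x - y) = realToComplex x - realToComplex y :=
  (realToComplexₗᵢ d).map_sub x y

theorem realToComplex_smul (c : ℝ) (x : EuclideanSpace ℝ (Fin d)) :
    realToComplex (c • x) = (c : ℂ) • realToComplex x := by
  ext i; simp [realToComplex]

@[fun_prop]
theorem continuous_realToComplex : Continuous (realToComplex (d := d)) :=
  (realToComplexₗᵢ d).continuous

/-- The Gaussian `σ ^ (-d) exp (-π (w₁² + ⋯ + w_d²) / σ²)` on `ℂ^d`. -/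
noncomputable def gaussKernel (σ : ℝ) (w : EuclideanSpace ℂ (Fin d)) : ℂ :=
  ((σ ^ d)⁻¹ : ℝ) * Complex.exp (-(Real.pi / σ ^ 2 : ℝ) * ∑ i, w i ^ 2)

theorem differentiable_gaussKernel (σ : ℝ) :
    Differentiable ℂ (gaussKernel σ : EuclideanSpace ℂ (Fin d) → ℂ) := by
  have : ∀ i : Fin d, Differentiable ℂ fun w : EuclideanSpace ℂ (Fin d) => w i := fun i =>
    (EuclideanSpace.proj (𝕜 := ℂ) i).differentiable
  unfold gaussKernel
  fun_prop

theorem gaussKernel_realToComplex (σ : ℝ) (x : EuclideanSpace ℝ (Fin d)) :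
    gaussKernel σ (realToComplex x) =
      ((σ ^ d)⁻¹ : ℝ) * (Real.exp (-(Real.pi / σ ^ 2) * ‖x‖ ^ 2) : ℝ) := by
  rw [gaussKernel, EuclideanSpace.real_norm_sq_eq]
  push_cast
  rfl

/-- In each coordinate, (Re w - u)² ≥ u²/2 - (Re w)². Thus the decay in u survives at a complex
point, at a cost controlled by ‖w‖² / σ². -/
theorem norm_gaussKernel_sub_le {σ : ℝ} (hσ : 0 < σ) (w : EuclideanSpace ℂ (Fin d))
    (u : EuclideanSpace ℝ (Fin d)) : ‖gaussKernel σ (w - realToComplex u)‖ ≤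
      (σ ^ d)⁻¹ * Real.exp (Real.pi / σ ^ 2 * (‖w‖ ^ 2 - ‖u‖ ^ 2 / 2)) := by
  rw [gaussKernel, norm_mul, Complex.norm_real, Real.norm_of_nonneg (by positivity),
    Complex.norm_exp]
  gcongr
  rw [← Complex.ofReal_neg, Complex.re_ofReal_mul, neg_mul, ← mul_neg]
  refine mul_le_mul_of_nonneg_left ?_ (by positivity)
  rw [EuclideanSpace.norm_sq_eq, EuclideanSpace.real_norm_sq_eq, Complex.re_sum,
    Finset.sum_div, ← Finset.sum_sub_distrib, ← Finset.sum_neg_distrib]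
  refine Finset.sum_le_sum fun i _ => ?_
  rw [← Complex.normSq_eq_norm_sq, Complex.normSq_apply, sq]
  simp only [realToComplex, PiLp.sub_apply, Complex.mul_re, Complex.sub_re, Complex.ofReal_re,
    Complex.sub_im, Complex.ofReal_im]
  nlinarith [sq_nonneg ((w i).re * 2 - u i), sq_nonneg (u i)]

theorem integrable_exp_neg_mul_sq_norm {b : ℝ} (hb : 0 < b) :
    Integrable fun v : EuclideanSpace ℝ (Fin d) => Real.exp (-b * ‖v‖ ^ 2) := by
  have h := GaussianFourier.integrable_cexp_neg_mul_sq_norm_add (V := EuclideanSpace ℝ (Fin d))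
    (b := (b : ℂ)) (by simpa using hb) 0 0
  refine h.norm.congr (ae_of_all _ fun v => ?_)
  simp [Complex.norm_exp, ← Complex.ofReal_pow]

theorem integrable_exp_mul_norm_mul_exp_neg_mul_sq_norm (m : ℝ) {b : ℝ} (hb : 0 < b) :
    Integrable fun v : EuclideanSpace ℝ (Fin d) =>
      Real.exp (m * ‖v‖) * Real.exp (-b * ‖v‖ ^ 2) := by
  refine ((integrable_exp_neg_mul_sq_norm (d := d) (half_pos hb)).const_mul
    (Real.exp (m ^ 2 / (2 * b)))).mono' ?_ (ae_of_all _ fun v => ?_)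
  · exact Continuous.aestronglyMeasurable (by fun_prop)
  · rw [Real.norm_of_nonneg (by positivity), ← Real.exp_add, ← Real.exp_add]
    have : m ^ 2 / (2 * b) + -(b / 2) * ‖v‖ ^ 2 - (m * ‖v‖ + -b * ‖v‖ ^ 2) =
        (m - b * ‖v‖) ^ 2 / (2 * b) := by field_simp; ring
    have h2 : 0 ≤ (m - b * ‖v‖) ^ 2 / (2 * b) := by positivity
    exact Real.exp_le_exp.2 (by linarith)

theorem integral_exp_neg_pi_mul_sq_norm :
    ∫ v : EuclideanSpace ℝ (Fin d), Real.exp (-Real.pi * ‖v‖ ^ 2) = 1 := by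
  rw [GaussianFourier.integral_rexp_neg_mul_sq_norm Real.pi_pos, div_self Real.pi_ne_zero,
    Real.one_rpow]

theorem exists_re_add_im (w : EuclideanSpace ℂ (Fin d)) : ∃ a b : EuclideanSpace ℝ (Fin d),
    w = realToComplex a + Complex.I • realToComplex b :=
  ⟨WithLp.toLp 2 fun i => (w i).re, WithLp.toLp 2 fun i => (w i).im, by
    ext i
    simp [realToComplex, mul_comm Complex.I, Complex.re_add_im]⟩

/-- Convolution of an entire function of exponential type with a Gaussian, at a complex point. -/
theorem integral_mul_gaussKernel_sub {P : EuclideanSpace ℂ (Fin d) → ℂ} (hP : Differentiable ℂ P)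
    {C m : ℝ} (hC : 0 ≤ C) (hm : 0 ≤ m) (hle : ∀ v, ‖P v‖ ≤ C * Real.exp (m * ‖v‖)) {σ : ℝ}
    (hσ : 0 < σ) (w : EuclideanSpace ℂ (Fin d)) :
    ∫ u, P (realToComplex u) * gaussKernel σ (w - realToComplex u) =
      ∫ y, P (w - (σ : ℂ) • realToComplex y) * (Real.exp (-Real.pi * ‖y‖ ^ 2) : ℝ) := by
  obtain ⟨a, b, rfl⟩ := exists_re_add_im w
  -- Both integrals are entire in t along this line. For real t they agree by the substitution u = a
  -- + t b - σ y, so the identity theorem gives equality at t = i.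
  let p : ℂ → EuclideanSpace ℂ (Fin d) := fun t => realToComplex a + t • realToComplex b
  have hp : Differentiable ℂ p := by fun_prop
  have hpn : ∀ t₀ : ℂ, ∀ t ∈ ball t₀ 1, ‖p t‖ ≤ ‖a‖ + (‖t₀‖ + 1) * ‖b‖ := by
    intro t₀ t ht
    refine (norm_add_le _ _).trans ?_
    rw [norm_smul, norm_realToComplex, norm_realToComplex]
    have : ‖t‖ ≤ ‖t₀‖ + 1 := by
      rw [mem_ball, dist_eq_norm] at ht
      linarith [norm_sub_norm_le t t₀]
    gcongr
  let f : ℂ → ℂ := fun t => ∫ u, P (realToComplex u) * gaussKernel σ (p t - realToComplex u)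
  let g : ℂ → ℂ := fun t =>
    ∫ y, P (p t - (σ : ℂ) • realToComplex y) * (Real.exp (-Real.pi * ‖y‖ ^ 2) : ℝ)
  have hPc := hP.continuous
  have hG := differentiable_gaussKernel (d := d) σ
  have hGc := hG.continuous
  have hf : Differentiable ℂ f := fun t₀ => by
    set ρ := ‖a‖ + (‖t₀‖ + 1) * ‖b‖
    refine differentiableAt_integral_of_dominated one_pos (bound := fun u =>
      C * ((σ ^ d)⁻¹ * Real.exp (Real.pi / σ ^ 2 * ρ ^ 2)) *
        (Real.exp (m * ‖u‖) * Real.exp (-(Real.pi / σ ^ 2 / 2) * ‖u‖ ^ 2))) ?_ ?_ ?_ ?_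
    · exact (integrable_exp_mul_norm_mul_exp_neg_mul_sq_norm m (by positivity)).const_mul _
    · exact fun t _ => Continuous.aestronglyMeasurable (by fun_prop)
    · intro u
      refine Differentiable.differentiableOn ((differentiable_const _).mul (hG.comp ?_))
      fun_prop
    · intro t ht u
      have h1 := hle (realToComplex u)
      rw [norm_realToComplex] at h1
      have h2 := norm_gaussKernel_sub_le hσ (p t) u
      rw [norm_mul]
      calc _ ≤ C * Real.exp (m * ‖u‖) * ((σ ^ d)⁻¹ *
            Real.exp (Real.pi / σ ^ 2 * (ρ ^ 2 - ‖u‖ ^ 2 / 2))) := by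
              refine mul_le_mul h1 (h2.trans ?_) (norm_nonneg _) (by positivity)
              have := hpn t₀ t ht
              gcongr
        _ = C * ((σ ^ d)⁻¹ * (Real.exp (Real.pi / σ ^ 2 * ρ ^ 2) *
              Real.exp (-(Real.pi / σ ^ 2 / 2) * ‖u‖ ^ 2))) * Real.exp (m * ‖u‖) := by
            rw [← Real.exp_add]; ring_nf
        _ = _ := by ring
  have hg : Differentiable ℂ g := fun t₀ => by
    set ρ := ‖a‖ + (‖t₀‖ + 1) * ‖b‖
    refine differentiableAt_integral_of_dominated one_pos (bound := fun y =>
      C * Real.exp (m * ρ) * (Real.exp (m * σ * ‖y‖) * Real.exp (-Real.pi * ‖y‖ ^ 2))) ?_ ?_ ?_ ?_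
    · exact (integrable_exp_mul_norm_mul_exp_neg_mul_sq_norm _ Real.pi_pos).const_mul _
    · exact fun t _ => Continuous.aestronglyMeasurable (by fun_prop)
    · intro u
      refine Differentiable.differentiableOn ((hP.comp ?_).mul (differentiable_const _))
      fun_prop
    · intro t ht y
      have h1 : ‖p t - (σ : ℂ) • realToComplex y‖ ≤ ρ + σ * ‖y‖ := by
        refine (norm_sub_le _ _).trans (add_le_add (hpn t₀ t ht) ?_)
        rw [norm_smul, norm_realToComplex, Complex.norm_real, Real.norm_of_nonneg hσ.le]
      rw [norm_mul, Complex.norm_real, Real.norm_of_nonneg (Real.exp_pos _).le, ← mul_assoc]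
      refine mul_le_mul_of_nonneg_right ((hle _).trans ?_) (Real.exp_pos _).le
      rw [mul_assoc, ← Real.exp_add]
      have : m * ‖p t - (σ : ℂ) • realToComplex y‖ ≤ m * (ρ + σ * ‖y‖) := by gcongr
      gcongr
      linarith
  have hreal : ∀ s : ℝ, f s = g s := by
    intro s
    have hps : p s = realToComplex (a + s • b) := by
      simp only [p]
      rw [← realToComplex_smul]
      exact ((realToComplexₗᵢ d).map_add a (s • b)).symm
    simp only [f, g, hps, ← realToComplex_smul, ← realToComplex_sub, gaussKernel_realToComplex]
    rw [← integral_sub_left_eq_self _ volume (a + s • b)]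
    simp only [sub_sub_cancel]
    have h := Measure.integral_comp_smul (volume : Measure (EuclideanSpace ℝ (Fin d)))
      (fun v => P (realToComplex (a + s • b - v)) *
        (Real.exp (-(Real.pi / σ ^ 2) * ‖v‖ ^ 2) : ℝ)) σ
    have e1 : ∀ y : EuclideanSpace ℝ (Fin d), -(Real.pi / σ ^ 2) * ‖σ • y‖ ^ 2 =
        -Real.pi * ‖y‖ ^ 2 := fun y => by
      rw [norm_smul, Real.norm_of_nonneg hσ.le]; field_simp
    simp only [e1] at h
    rw [h, finrank_euclideanSpace_fin, abs_of_pos (by positivity), ← integral_smul]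
    congr 1
    ext v
    rw [Complex.real_smul]
    ring
  have heq : f = g := by
    refine AnalyticOnNhd.eq_of_frequently_eq (z₀ := 0)
      (hf.differentiableOn.analyticOnNhd isOpen_univ)
      (hg.differentiableOn.analyticOnNhd isOpen_univ) ?_
    have ht : Tendsto (fun n : ℕ => ((1 / ((n : ℝ) + 1) : ℝ) : ℂ)) atTop (𝓝[≠] 0) := by
      refine tendsto_nhdsWithin_iff.2 ⟨?_, Eventually.of_forall fun n => ?_⟩
      · have := tendsto_one_div_add_atTop_nhds_zero_nat (𝕜 := ℝ)
        exact_mod_cast (Complex.continuous_ofReal.tendsto 0).comp this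
      · simp only [mem_compl_iff, mem_singleton_iff, Complex.ofReal_eq_zero]
        positivity
    exact ht.frequently (Eventually.of_forall fun n => hreal _).frequently
  exact congrFun heq Complex.I

end Gaussian

/-! ### Complexified Taylor series and remainders under analytic bounds. -/

section TaylorSeries

variable {d : ℕ}

/-- The quotient of n! by α! is a multinomial coefficient. Replacing α! by n! costs nothing here,
since the estimates sum over sequences of directions. -/
theorem prod_multiIndex_factorial_le {n : ℕ} (i : Fin n → Fin d) :
    ∏ j, ((multiIndex i j).factorial : ℝ) ≤ n.factorial := by
  have h1 : ∑ j, multiIndex i j = n := by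
    have := Finset.card_eq_sum_card_fiberwise (f := i) (s := Finset.univ) (t := Finset.univ)
      (fun _ _ => Finset.mem_coe.2 (Finset.mem_univ _))
    simpa [multiIndex] using this.symm
  have h2 := Nat.le_of_dvd (Nat.factorial_pos _)
    (Nat.prod_factorial_dvd_factorial_sum Finset.univ (multiIndex i))
  rw [h1] at h2
  exact_mod_cast h2

/-- The monomial `w ↦ w (i 0) ⋯ w (i (n - 1))` on `ℂ^d`. -/
noncomputable def coordMonomial {n : ℕ} (i : Fin n → Fin d) :
    ContinuousMultilinearMap ℂ (fun _ : Fin n => EuclideanSpace ℂ (Fin d)) ℂ :=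
  (ContinuousMultilinearMap.mkPiAlgebra ℂ (Fin n) ℂ).compContinuousLinearMap
    fun k => EuclideanSpace.proj (i k)

theorem coordMonomial_apply {n : ℕ} (i : Fin n → Fin d) (v : Fin n → EuclideanSpace ℂ (Fin d)) :
    coordMonomial i v = ∏ k, v k (i k) := by
  simp [coordMonomial]

theorem norm_coordMonomial_le {n : ℕ} (i : Fin n → Fin d) : ‖coordMonomial i‖ ≤ 1 := by
  refine ContinuousMultilinearMap.opNorm_le_bound zero_le_one fun v => ?_
  rw [coordMonomial_apply, one_mul, norm_prod]
  exact Finset.prod_le_prod (fun _ _ => norm_nonneg _) fun k _ => PiLp.norm_apply_le _ _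

theorem iteratedFDeriv_apply_eq_sum (g : EuclideanSpace ℝ (Fin d) → ℂ) (n : ℕ)
    (x v : EuclideanSpace ℝ (Fin d)) : iteratedFDeriv ℝ n g x (fun _ => v) =
      ∑ i : Fin n → Fin d, (∏ k, v (i k)) • partialDeriv g i x := by
  have hv : v = ∑ j, v j • EuclideanSpace.single j (1 : ℝ) := by
    ext k; simp [Pi.single_apply]
  conv_lhs => rw [hv]
  rw [ContinuousMultilinearMap.map_sum]
  exact Finset.sum_congr rfl fun i _ => ContinuousMultilinearMap.map_smul_univ _ _ _

/-- The complexified Taylor series of `g` at `x₀`. -/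
noncomputable def complexTaylorSeries (g : EuclideanSpace ℝ (Fin d) → ℂ)
    (x₀ : EuclideanSpace ℝ (Fin d)) :
    FormalMultilinearSeries ℂ (EuclideanSpace ℂ (Fin d)) ℂ :=
  fun n => ((n.factorial : ℂ)⁻¹) • ∑ i : Fin n → Fin d, partialDeriv g i x₀ • coordMonomial i

theorem complexTaylorSeries_apply_realToComplex (g : EuclideanSpace ℝ (Fin d) → ℂ)
    (x₀ v : EuclideanSpace ℝ (Fin d)) (n : ℕ) :
    complexTaylorSeries g x₀ n (fun _ => realToComplex v) =
      ((n.factorial : ℝ)⁻¹) • iteratedFDeriv ℝ n g x₀ (fun _ => v) := by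
  rw [iteratedFDeriv_apply_eq_sum, complexTaylorSeries]
  simp only [smul_apply, sum_apply, coordMonomial_apply, realToComplex, Complex.real_smul,
    smul_eq_mul]
  push_cast
  congr 1
  exact Finset.sum_congr rfl fun i _ => mul_comm _ _

/-- The estimates which define analyticity, on the set `B` and with the factor `e`. -/
def AnalyticBound (g : EuclideanSpace ℝ (Fin d) → ℂ) (B : Set (EuclideanSpace ℝ (Fin d)))
    (η e : ℝ) : Prop :=
  ∀ (n : ℕ) (i : Fin n → Fin d), ∀ x ∈ B,
    ‖partialDeriv g i x‖ ≤ η ^ (n + 1) * (∏ j, ((multiIndex i j).factorial : ℝ)) * e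

variable {g : EuclideanSpace ℝ (Fin d) → ℂ} {B : Set (EuclideanSpace ℝ (Fin d))} {η e : ℝ}

theorem AnalyticBound.norm_le (h : AnalyticBound g B η e) (hη : 0 < η) (he : 0 ≤ e) {n : ℕ}
    (i : Fin n → Fin d) {x : EuclideanSpace ℝ (Fin d)} (hx : x ∈ B) :
    ‖partialDeriv g i x‖ ≤ η ^ (n + 1) * n.factorial * e := by
  refine (h n i x hx).trans ?_
  gcongr
  exact prod_multiIndex_factorial_le i

theorem AnalyticBound.norm_complexTaylorSeries_le (h : AnalyticBound g B η e) (hη : 0 < η)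
    (he : 0 ≤ e) {x₀ : EuclideanSpace ℝ (Fin d)} (hx₀ : x₀ ∈ B) (n : ℕ) :
    ‖complexTaylorSeries g x₀ n‖ ≤ η * e * ((d + 1) * η) ^ n := by
  rw [complexTaylorSeries, norm_smul, norm_inv, Complex.norm_natCast]
  have h1 : ‖∑ i : Fin n → Fin d, partialDeriv g i x₀ • coordMonomial i‖ ≤
      ∑ _i : Fin n → Fin d, η ^ (n + 1) * n.factorial * e := by
    refine norm_sum_le_of_le _ fun i _ => ?_
    rw [norm_smul]
    exact (mul_le_of_le_one_right (norm_nonneg _) (norm_coordMonomial_le i)).trans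
      (h.norm_le hη he i hx₀)
  rw [Finset.sum_const, Finset.card_univ, Fintype.card_fun, Fintype.card_fin, Fintype.card_fin,
    nsmul_eq_mul] at h1
  rw [inv_mul_le_iff₀ (by positivity)]
  refine h1.trans ?_
  -- Using d + 1 keeps the ratio (d + 1) η positive when d = 0.
  have h2 : (d : ℝ) ^ n ≤ (d + 1) ^ n := pow_le_pow_left₀ (by positivity) (by linarith) n
  push_cast
  calc (d : ℝ) ^ n * (η ^ (n + 1) * n.factorial * e)
      ≤ (d + 1) ^ n * (η ^ (n + 1) * n.factorial * e) := by gcongr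
    _ = _ := by rw [mul_pow]; ring

theorem AnalyticBound.norm_iteratedFDeriv_apply_le (h : AnalyticBound g B η e) (hη : 0 < η)
    (he : 0 ≤ e) {x : EuclideanSpace ℝ (Fin d)} (hx : x ∈ B) (n : ℕ)
    (v : EuclideanSpace ℝ (Fin d)) :
    ‖iteratedFDeriv ℝ n g x fun _ => v‖ ≤ η * e * ((d + 1) * η * ‖v‖) ^ n * n.factorial := by
  rw [iteratedFDeriv_apply_eq_sum]
  have h1 : ‖∑ i : Fin n → Fin d, (∏ k, v (i k)) • partialDeriv g i x‖ ≤
      ∑ _i : Fin n → Fin d, ‖v‖ ^ n * (η ^ (n + 1) * n.factorial * e) := by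
    refine norm_sum_le_of_le _ fun i _ => ?_
    rw [norm_smul]
    refine mul_le_mul ?_ (h.norm_le hη he i hx) (norm_nonneg _) (by positivity)
    rw [norm_prod]
    refine (Finset.prod_le_prod (fun _ _ => norm_nonneg _) fun k _ =>
      PiLp.norm_apply_le v (i k)).trans ?_
    simp
  rw [Finset.sum_const, Finset.card_univ, Fintype.card_fun, Fintype.card_fin, Fintype.card_fin,
    nsmul_eq_mul] at h1
  refine h1.trans ?_
  have h2 : (d : ℝ) ^ n ≤ (d + 1) ^ n := pow_le_pow_left₀ (by positivity) (by linarith) n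
  push_cast
  calc (d : ℝ) ^ n * (‖v‖ ^ n * (η ^ (n + 1) * n.factorial * e))
      ≤ (d + 1) ^ n * (‖v‖ ^ n * (η ^ (n + 1) * n.factorial * e)) := by gcongr
    _ = _ := by rw [mul_pow, mul_pow]; ring

theorem hasDerivAt_iteratedFDeriv_line {E F : Type*} [NormedAddCommGroup E] [NormedSpace ℝ E]
    [NormedAddCommGroup F] [NormedSpace ℝ F] {g : E → F} {B : Set E} (hB : IsOpen B)
    (hg : ContDiffOn ℝ ((⊤ : ℕ∞) : WithTop ℕ∞) g B) (x v : E) (n : ℕ) {t : ℝ}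
    (ht : x + t • v ∈ B) :
    HasDerivAt (fun t : ℝ => iteratedFDeriv ℝ n g (x + t • v) fun _ => v)
      (iteratedFDeriv ℝ (n + 1) g (x + t • v) fun _ => v) t := by
  have h1 : HasDerivAt (fun t : ℝ => x + t • v) v t := by
    simpa using ((hasDerivAt_id t).smul_const v).const_add x
  have h2 : DifferentiableAt ℝ (iteratedFDeriv ℝ n g) (x + t • v) :=
    ((hg.contDiffAt (hB.mem_nhds ht))).differentiableAt_iteratedFDeriv
      (by exact_mod_cast WithTop.coe_lt_top _)
  have h3 := h2.hasFDerivAt.comp_hasDerivAt t h1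
  have h4 := (ContinuousMultilinearMap.apply ℝ (fun _ : Fin n => E) F
    (fun _ => v)).hasFDerivAt.comp_hasDerivAt t h3
  rw [iteratedFDeriv_succ_apply_left]
  exact h4

theorem iteratedDerivWithin_line {E F : Type*} [NormedAddCommGroup E] [NormedSpace ℝ E]
    [NormedAddCommGroup F] [NormedSpace ℝ F] {g : E → F} {B : Set E} (hB : IsOpen B)
    (hg : ContDiffOn ℝ ((⊤ : ℕ∞) : WithTop ℕ∞) g B) (x v : E)
    (hv : ∀ t ∈ Icc (0 : ℝ) 1, x + t • v ∈ B) (n : ℕ) {t : ℝ} (ht : t ∈ Icc (0 : ℝ) 1) :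
    iteratedDerivWithin n (fun t : ℝ => g (x + t • v)) (Icc 0 1) t =
      iteratedFDeriv ℝ n g (x + t • v) fun _ => v := by
  induction n generalizing t with
  | zero => simp
  | succ n ih =>
    rw [iteratedDerivWithin_succ, derivWithin_congr (fun s hs => ih hs) (ih ht)]
    exact (hasDerivAt_iteratedFDeriv_line hB hg x v n (hv t ht)).hasDerivWithinAt.derivWithin
      (uniqueDiffOn_Icc zero_lt_one t ht)

/-- Taylor's theorem under analytic bounds. -/
theorem AnalyticBound.norm_sub_partialSum_le {x₀ : EuclideanSpace ℝ (Fin d)} {r : ℝ}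
    (h : AnalyticBound g (ball x₀ r) η e) (hη : 0 < η) (he : 0 ≤ e)
    (hg : ContDiffOn ℝ ((⊤ : ℕ∞) : WithTop ℕ∞) g (ball x₀ r)) {v : EuclideanSpace ℝ (Fin d)}
    (hv : ‖v‖ < r) (n : ℕ) :
    ‖g (x₀ + v) - (complexTaylorSeries g x₀).partialSum (n + 1) (realToComplex v)‖ ≤
      η * e * (2 * ((d + 1) * η * ‖v‖)) ^ (n + 1) := by
  have hball : ∀ t ∈ Icc (0 : ℝ) 1, x₀ + t • v ∈ ball x₀ r := fun t ht => by
    rw [mem_ball, dist_eq_norm, add_sub_cancel_left, norm_smul, Real.norm_of_nonneg ht.1]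
    exact (mul_le_of_le_one_left (norm_nonneg _) ht.2).trans_lt hv
  have hcd : ContDiffOn ℝ ((n : WithTop ℕ∞) + 1) (fun t : ℝ => g (x₀ + t • v)) (Icc 0 1) :=
    (hg.of_le (by exact_mod_cast le_top)).comp (ContDiff.contDiffOn (by fun_prop)) hball
  -- One-variable Taylor theorem along the segment from x₀ to x₀ + v.
  have key := taylor_mean_remainder_bound zero_le_one hcd (right_mem_Icc.2 zero_le_one)
    (C := η * e * ((d + 1) * η * ‖v‖) ^ (n + 1) * (n + 1).factorial) fun t ht => by
      rw [iteratedDerivWithin_line isOpen_ball hg x₀ v hball (n + 1) ht]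
      exact h.norm_iteratedFDeriv_apply_le hη he (hball t ht) (n + 1) v
  rw [taylor_within_apply] at key
  have hsum : ∑ k ∈ Finset.range (n + 1), ((k.factorial : ℝ)⁻¹ * (1 - 0) ^ k) •
      iteratedDerivWithin k (fun t : ℝ => g (x₀ + t • v)) (Icc 0 1) 0 =
      (complexTaylorSeries g x₀).partialSum (n + 1) (realToComplex v) := by
    refine Finset.sum_congr rfl fun k _ => ?_
    rw [iteratedDerivWithin_line isOpen_ball hg x₀ v hball k (left_mem_Icc.2 zero_le_one),
      complexTaylorSeries_apply_realToComplex]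
    simp
  rw [hsum, one_smul] at key
  refine key.trans ?_
  have hX : 0 ≤ ((d + 1) * η * ‖v‖) ^ (n + 1) := by positivity
  rw [div_le_iff₀ (by positivity), mul_pow 2, Nat.factorial_succ]
  generalize ((d + 1) * η * ‖v‖) ^ (n + 1) = X at hX ⊢
  -- The remainder bound divides by n! only; the leftover factor n + 1 explains the 2 in the ratio.
  have h2 : ((n + 1 : ℕ) : ℝ) ≤ 2 ^ (n + 1) := by exact_mod_cast (Nat.lt_two_pow_self).le
  push_cast at h2 ⊢
  calc _ = (n + 1 : ℝ) * (η * e * X * n.factorial) := by ring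
    _ ≤ 2 ^ (n + 1) * (η * e * X * n.factorial) := by gcongr
    _ = _ := by ring

end TaylorSeries

/-! ### Power series with geometrically bounded terms. -/

section GeometricSeries

variable {d : ℕ} {p : FormalMultilinearSeries ℂ (EuclideanSpace ℂ (Fin d)) ℂ} {M κ : ℝ}

theorem differentiable_partialSum (p : FormalMultilinearSeries ℂ (EuclideanSpace ℂ (Fin d)) ℂ)
    (N : ℕ) : Differentiable ℂ (p.partialSum N) := by
  unfold FormalMultilinearSeries.partialSum
  refine Differentiable.fun_sum fun n _ => ?_
  exact ((p n).contDiff (n := 1)).differentiable one_ne_zero |>.comp (by fun_prop)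

theorem norm_apply_le_of_geometric (hp : ∀ n, ‖p n‖ ≤ M * κ ^ n) (n : ℕ)
    (w : EuclideanSpace ℂ (Fin d)) : ‖p n fun _ => w‖ ≤ M * (κ * ‖w‖) ^ n := by
  refine ((p n).le_opNorm _).trans ?_
  rw [Finset.prod_const, Finset.card_univ, Fintype.card_fin, mul_pow, ← mul_assoc]
  exact mul_le_mul_of_nonneg_right (hp n) (by positivity)

/-- The geometric sum of N terms is at most (1 + x)^N ≤ exp(N x). Exponential growth at rate N κ can
be absorbed by the Gaussian far from the centre. -/
theorem norm_partialSum_le_exp (hM : 0 ≤ M) (hκ : 0 ≤ κ) (hp : ∀ n, ‖p n‖ ≤ M * κ ^ n) (N : ℕ)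
    (w : EuclideanSpace ℂ (Fin d)) : ‖p.partialSum N w‖ ≤ M * Real.exp (N * κ * ‖w‖) := by
  have hx : 0 ≤ κ * ‖w‖ := by positivity
  have h1 : ∀ x : ℝ, 0 ≤ x → ∑ n ∈ Finset.range N, x ^ n ≤ (x + 1) ^ N := by
    intro x hx
    induction N with
    | zero => simp
    | succ N ih =>
      rw [Finset.sum_range_succ, pow_succ]
      have : x ^ N ≤ (x + 1) ^ N := pow_le_pow_left₀ hx (by linarith) N
      have h3 := pow_nonneg (by linarith : 0 ≤ x + 1) N
      rcases N.eq_zero_or_pos with rfl | hN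
      · simpa using hx
      · have h4 : x ^ N ≤ x * (x + 1) ^ N := by
          obtain ⟨k, rfl⟩ := Nat.exists_eq_succ_of_ne_zero hN.ne'
          rw [pow_succ, mul_comm]
          refine mul_le_mul_of_nonneg_left ?_ hx
          calc x ^ k ≤ (x + 1) ^ k := pow_le_pow_left₀ hx (by linarith) k
            _ ≤ (x + 1) ^ (k + 1) := pow_le_pow_right₀ (by linarith) (by omega)
        nlinarith
  refine (norm_sum_le_of_le _ fun n _ => norm_apply_le_of_geometric hp n w).trans ?_
  rw [← Finset.mul_sum, mul_assoc, Real.exp_nat_mul]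
  refine mul_le_mul_of_nonneg_left ((h1 _ hx).trans ?_) hM
  exact pow_le_pow_left₀ (by linarith) (Real.add_one_le_exp _) N

theorem hasFPowerSeriesOnBall_sum (hκ : 0 < κ) (hp : ∀ n, ‖p n‖ ≤ M * κ ^ n) :
    HasFPowerSeriesOnBall p.sum p 0 (ENNReal.ofReal κ⁻¹) := by
  have hr : ENNReal.ofReal κ⁻¹ ≤ p.radius := by
    refine p.le_radius_of_bound M fun n => ?_
    rw [Real.coe_toNNReal _ (by positivity)]
    calc ‖p n‖ * κ⁻¹ ^ n ≤ M * κ ^ n * κ⁻¹ ^ n := by gcongr; exact hp n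
      _ = M := by rw [mul_assoc, ← mul_pow, mul_inv_cancel₀ hκ.ne', one_pow, mul_one]
  have h0 : 0 < ENNReal.ofReal κ⁻¹ := ENNReal.ofReal_pos.2 (by positivity)
  exact (p.hasFPowerSeriesOnBall (h0.trans_le hr)).mono h0 hr

theorem differentiableOn_sum (hκ : 0 < κ) (hp : ∀ n, ‖p n‖ ≤ M * κ ^ n) :
    DifferentiableOn ℂ p.sum (ball 0 κ⁻¹) := by
  have := (hasFPowerSeriesOnBall_sum hκ hp).differentiableOn
  rwa [Metric.eball_ofReal] at this

theorem norm_sum_sub_partialSum_le (hM : 0 ≤ M) (hp : ∀ n, ‖p n‖ ≤ M * κ ^ n) (hκ : 0 < κ)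
    {w : EuclideanSpace ℂ (Fin d)} (hw : κ * ‖w‖ ≤ 1 / 2) (N : ℕ) :
    ‖p.sum w - p.partialSum N w‖ ≤ 2 * M * (1 / 2) ^ N := by
  have hs : HasSum (fun n => p n fun _ => w) (p.sum w) := by
    have := (hasFPowerSeriesOnBall_sum hκ hp).hasSum (y := w) (by
      rw [Metric.eball_ofReal, mem_ball_zero_iff, ← one_div, lt_div_iff₀ hκ]
      linarith)
    simpa using this
  have hs' := (hasSum_nat_add_iff' N).2 hs
  have hg : HasSum (fun n => M * (1 / 2 : ℝ) ^ (n + N)) (2 * M * (1 / 2) ^ N) := by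
    have := (hasSum_geometric_two.mul_left (M * (1 / 2) ^ N))
    simpa only [pow_add, mul_assoc, mul_left_comm, mul_comm] using this
  rw [FormalMultilinearSeries.partialSum, ← hs'.tsum_eq]
  refine tsum_of_norm_bounded hg fun n => (norm_apply_le_of_geometric hp _ w).trans ?_
  gcongr

end GeometricSeries

/-! ### Extrapolation error on Taylor polynomials. -/

section Extrapolation

variable {d : ℕ} {p : FormalMultilinearSeries ℂ (EuclideanSpace ℂ (Fin d)) ℂ} {M κ : ℝ}

/-- Nodes in `[1, 2]` and weights which extrapolate polynomials of degree at most `D` to `0`. -/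
structure IsExtrapolation (D : ℕ) (v c : ℕ → ℝ) : Prop where
  mem_Icc : ∀ j ∈ Finset.range (D + 1), v j ∈ Icc 1 2
  sum_eq_one : ∑ j ∈ Finset.range (D + 1), c j = 1
  sum_mul_pow : ∀ k, 1 ≤ k → k ≤ D → ∑ j ∈ Finset.range (D + 1), c j * v j ^ k = 0
  sum_abs_le : ∑ j ∈ Finset.range (D + 1), |c j| ≤ Real.exp (4 * D)

/-- For k > 0, since k b² e^14 ≤ 3 < π, one has (b e^7 r)² ≤ π r²/k ≤ exp(π r²/k); raise to the
power k and take square roots. Half of the Gaussian exponent thus absorbs the power with a gain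
e^(-7k). -/
theorem pow_le_exp_neg_mul_exp_sq {b r : ℝ} {k N : ℕ} (hk : k ≤ N)
    (hN : b ^ 2 * Real.exp 14 * N ≤ 3) :
    (b * r) ^ k ≤ Real.exp (-7 * k) * Real.exp (Real.pi / 2 * r ^ 2) := by
  rcases k.eq_zero_or_pos with rfl | hk0
  · simp only [pow_zero, Nat.cast_zero, mul_zero, Real.exp_zero, one_mul]
    exact Real.one_le_exp (by positivity)
  have hk0' : (0 : ℝ) < k := by exact_mod_cast hk0
  have hkN : (k : ℝ) ≤ N := by exact_mod_cast hk
  have h14 : Real.exp 14 = Real.exp 7 ^ 2 := by rw [← Real.exp_nat_mul]; norm_num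
  have h1 : (b * Real.exp 7 * r) ^ 2 ≤ Real.exp (Real.pi * r ^ 2 / k) := by
    have h2 : b ^ 2 * Real.exp 14 * k ≤ Real.pi :=
      ((mul_le_mul_of_nonneg_left hkN (by positivity)).trans hN).trans Real.pi_gt_three.le
    have h3 : b ^ 2 * Real.exp 14 ≤ Real.pi / k := (le_div_iff₀ hk0').2 h2
    calc (b * Real.exp 7 * r) ^ 2 = b ^ 2 * Real.exp 14 * r ^ 2 := by rw [h14]; ring
      _ ≤ Real.pi / k * r ^ 2 := by gcongr
      _ = Real.pi * r ^ 2 / k := by ring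
      _ ≤ Real.exp (Real.pi * r ^ 2 / k) := by linarith [Real.add_one_le_exp (Real.pi * r ^ 2 / k)]
  have h4 : ((b * Real.exp 7 * r) ^ k) ^ 2 ≤ Real.exp (Real.pi / 2 * r ^ 2) ^ 2 := by
    calc ((b * Real.exp 7 * r) ^ k) ^ 2 = ((b * Real.exp 7 * r) ^ 2) ^ k := by
          rw [← pow_mul, ← pow_mul, mul_comm k 2]
      _ ≤ Real.exp (Real.pi * r ^ 2 / k) ^ k := pow_le_pow_left₀ (by positivity) h1 k
      _ = Real.exp (Real.pi / 2 * r ^ 2) ^ 2 := by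
          rw [← Real.exp_nat_mul, ← Real.exp_nat_mul]
          congr 1
          field_simp
          norm_num
  have h5 := abs_le_of_sq_le_sq' h4 (Real.exp_pos _).le
  have h6 : Real.exp (-7 * k) = (Real.exp 7 ^ k)⁻¹ := by
    rw [← Real.exp_nat_mul, ← Real.exp_neg]; congr 1; ring
  rw [h6, inv_mul_eq_div, le_div_iff₀ (by positivity), ← mul_pow]
  calc (b * r * Real.exp 7) ^ k = (b * Real.exp 7 * r) ^ k := by ring
    _ ≤ _ := h5.2

/-- Multilinear binomial expansion: t is the set of slots that receive Y, so its cardinality is the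
degree in τ. -/
theorem map_sub_smul_const {n : ℕ}
    (f : ContinuousMultilinearMap ℂ (fun _ : Fin n => EuclideanSpace ℂ (Fin d)) ℂ)
    (w Y : EuclideanSpace ℂ (Fin d)) (τ : ℂ) :
    (f fun _ => w - τ • Y) =
      ∑ t : Finset (Fin n), (-τ) ^ t.card * f (t.piecewise (fun _ => Y) fun _ => w) := by
  have h1 : (fun _ : Fin n => w - τ • Y) = (fun _ => (-τ) • Y) + fun _ => w := by
    ext1 k; simp only [Pi.add_apply, neg_smul]; abel
  rw [h1, ContinuousMultilinearMap.map_add_univ]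
  refine Finset.sum_congr rfl fun t _ => ?_
  have h2 : t.piecewise (fun _ : Fin n => (-τ) • Y) (fun _ => w) =
      t.piecewise (fun i => (-τ) • (t.piecewise (fun _ => Y) fun _ => w : Fin n → _) i)
        (t.piecewise (fun _ => Y) fun _ => w) := by
    ext1 k
    by_cases hk : k ∈ t <;> simp [hk]
  rw [h2, f.map_piecewise_smul (fun _ => -τ), Finset.prod_const, smul_eq_mul]

theorem norm_apply_piecewise_le {n : ℕ}
    (f : ContinuousMultilinearMap ℂ (fun _ : Fin n => EuclideanSpace ℂ (Fin d)) ℂ)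
    (w Y : EuclideanSpace ℂ (Fin d)) (t : Finset (Fin n)) :
    ‖f (t.piecewise (fun _ => Y) fun _ => w)‖ ≤ ‖f‖ * (‖Y‖ ^ t.card * ‖w‖ ^ (n - t.card)) := by
  refine (f.le_opNorm _).trans_eq ?_
  congr 1
  have : ∀ i, ‖(t.piecewise (fun _ => Y) (fun _ => w) : Fin n → EuclideanSpace ℂ (Fin d)) i‖ =
      t.piecewise (fun _ => ‖Y‖) (fun _ => ‖w‖) i := fun i => by
    by_cases hi : i ∈ t <;> simp [hi]
  simp only [this]
  rw [Finset.prod_piecewise, Finset.prod_const, Finset.prod_const, Finset.univ_inter,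
    ← Finset.compl_eq_univ_sdiff, Finset.card_compl, Fintype.card_fin]

/-- Expand in powers of the width. Degree 0 is reproduced and degrees 1 to D are annihilated by the
weights. In a degree k > D the gain e^(-7k) pays for the weights e^(4D), for the factor e^(-D) and
for a summable 4^(-k), as 7 = 4 + 1 + 2. -/
theorem IsExtrapolation.norm_sub_partialSum_le {D : ℕ} {v c : ℕ → ℝ}
    (h : IsExtrapolation D v c) (hM : 0 ≤ M) (hκ : 0 < κ) (hp : ∀ n, ‖p n‖ ≤ M * κ ^ n)
    {w : EuclideanSpace ℂ (Fin d)} (hw : κ * ‖w‖ ≤ 1 / 2) {s : ℝ} (hs : 0 < s) {N : ℕ}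
    (hN : (2 * s * κ) ^ 2 * Real.exp 14 * N ≤ 3) (Y : EuclideanSpace ℂ (Fin d)) :
    ‖∑ j ∈ Finset.range (D + 1), (c j : ℂ) * p.partialSum N (w - ((s * v j : ℝ) : ℂ) • Y) -
      p.partialSum N w‖ ≤ 4 * M * Real.exp (-D) * Real.exp (Real.pi / 2 * ‖Y‖ ^ 2) := by
  set X := M * Real.exp (-D) * Real.exp (Real.pi / 2 * ‖Y‖ ^ 2) with hX
  let b : ℕ → ℂ := fun k =>
    ∑ j ∈ Finset.range (D + 1), (c j : ℂ) * (-((s * v j : ℝ) : ℂ)) ^ k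
  have hb0 : b 0 = 1 := by
    simp only [b, pow_zero, mul_one]
    exact_mod_cast h.sum_eq_one
  have hbD : ∀ k, 1 ≤ k → k ≤ D → b k = 0 := fun k h1 h2 => by
    have : b k = (-s : ℂ) ^ k * ((∑ j ∈ Finset.range (D + 1), c j * v j ^ k : ℝ) : ℂ) := by
      simp only [b]
      push_cast
      rw [Finset.mul_sum]
      refine Finset.sum_congr rfl fun j _ => ?_
      rw [← neg_mul, mul_pow]; ring
    rw [this, h.sum_mul_pow k h1 h2]; simp
  have hble : ∀ k, ‖b k‖ ≤ Real.exp (4 * D) * (2 * s) ^ k := fun k => by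
    refine (norm_sum_le_of_le (n := fun j => |c j| * (2 * s) ^ k) _ fun j hj => ?_).trans ?_
    · rw [norm_mul, norm_pow, norm_neg, Complex.norm_real, Complex.norm_real, Real.norm_eq_abs]
      have := h.mem_Icc j hj
      rw [Real.norm_of_nonneg (mul_nonneg hs.le (by linarith [this.1]))]
      have h2 : s * v j ≤ 2 * s := by nlinarith [this.2]
      have h3 : 0 ≤ s * v j := mul_nonneg hs.le (by linarith [this.1])
      gcongr
    · rw [← Finset.sum_mul]
      exact mul_le_mul_of_nonneg_right h.sum_abs_le (by positivity)
  have hterm : ∀ n < N, ‖∑ j ∈ Finset.range (D + 1), (c j : ℂ) *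
      (p n fun _ => w - ((s * v j : ℝ) : ℂ) • Y) - p n fun _ => w‖ ≤ X * (3 / 4) ^ n := by
    intro n hn
    have e1 : ∑ j ∈ Finset.range (D + 1), (c j : ℂ) * (p n fun _ => w - ((s * v j : ℝ) : ℂ) • Y) =
        ∑ t : Finset (Fin n), b t.card * p n (t.piecewise (fun _ => Y) fun _ => w) := by
      simp only [map_sub_smul_const, Finset.mul_sum, b, Finset.sum_mul]
      rw [Finset.sum_comm]
      simp only [mul_assoc]
    have e2 : (p n fun _ => w) = ∑ t : Finset (Fin n), (if t.card = 0 then 1 else 0) *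
        p n (t.piecewise (fun _ => Y) fun _ => w) := by
      simp only [Finset.card_eq_zero, ite_mul, one_mul, zero_mul]
      rw [Finset.sum_ite_eq' Finset.univ ∅]
      simp
    rw [e1, e2, ← Finset.sum_sub_distrib]
    -- Slots with Y contribute 1/4 and slots with w contribute 1/2, so the sum over subsets is (1/4
    -- + 1/2)^n.
    have hsum : ∑ t : Finset (Fin n), X * ((1 / 4 : ℝ) ^ t.card * (1 / 2) ^ (n - t.card)) =
        X * (3 / 4) ^ n := by
      rw [← Finset.mul_sum]
      have := Fintype.sum_pow_mul_eq_add_pow (Fin n) (1 / 4 : ℝ) (1 / 2)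
      rw [Fintype.card_fin] at this
      rw [this]; norm_num
    rw [← hsum]
    refine norm_sum_le_of_le _ fun t _ => ?_
    rw [← sub_mul]
    have hXpos : 0 ≤ X := by positivity
    have htn : t.card ≤ n := by simpa using t.card_le_univ
    rcases Nat.eq_zero_or_pos t.card with h0 | h0
    · rw [h0, hb0, if_pos rfl, sub_self, zero_mul, norm_zero]; positivity
    rw [if_neg h0.ne', sub_zero]
    rcases le_or_gt t.card D with hD | hD
    · rw [hbD _ h0 hD, zero_mul, norm_zero]; positivity
    rw [norm_mul]
    set k := t.card
    have h3 := norm_apply_piecewise_le (p n) w Y t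
    have h4 := pow_le_exp_neg_mul_exp_sq (b := 2 * s * κ) (r := ‖Y‖) (htn.trans hn.le) hN
    have h5 : Real.exp (4 * D) * Real.exp (-7 * k) ≤ Real.exp (-D) * (1 / 4) ^ k := by
      have hD' : (D : ℝ) ≤ k := by exact_mod_cast hD.le
      have h6 : Real.exp (-2) ≤ 1 / 4 := by
        rw [Real.exp_neg, inv_le_comm₀ (Real.exp_pos _) (by norm_num)]
        have h7 : Real.exp 2 = Real.exp 1 * Real.exp 1 := by rw [← Real.exp_add]; norm_num
        have h8 : (2 : ℝ) ≤ Real.exp 1 := by linarith [Real.add_one_le_exp (1 : ℝ)]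
        rw [h7]; nlinarith
      calc Real.exp (4 * D) * Real.exp (-7 * k) ≤ Real.exp (-D) * Real.exp (k * (-2)) := by
            rw [← Real.exp_add, ← Real.exp_add]
            exact Real.exp_le_exp.2 (by linarith)
        _ ≤ Real.exp (-D) * (1 / 4) ^ k := by
            rw [Real.exp_nat_mul]; gcongr
    calc ‖b k‖ * ‖p n (t.piecewise (fun _ => Y) fun _ => w)‖
        ≤ (Real.exp (4 * D) * (2 * s) ^ k) *
            (M * κ ^ n * (‖Y‖ ^ k * ‖w‖ ^ (n - k))) := by
          refine mul_le_mul (hble k) (h3.trans ?_) (norm_nonneg _) (by positivity)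
          exact mul_le_mul_of_nonneg_right (hp n) (by positivity)
      _ = Real.exp (4 * D) * M * (2 * s * κ * ‖Y‖) ^ k * (κ * ‖w‖) ^ (n - k) := by
          conv_lhs => rw [← Nat.add_sub_of_le htn, pow_add, Nat.add_sub_of_le htn]
          simp only [mul_pow]; ring
      _ ≤ Real.exp (4 * D) * M * (Real.exp (-7 * k) * Real.exp (Real.pi / 2 * ‖Y‖ ^ 2)) *
            (1 / 2) ^ (n - k) := by gcongr
      _ = M * Real.exp (Real.pi / 2 * ‖Y‖ ^ 2) * (Real.exp (4 * D) * Real.exp (-7 * k)) *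
            (1 / 2) ^ (n - k) := by ring
      _ ≤ M * Real.exp (Real.pi / 2 * ‖Y‖ ^ 2) * (Real.exp (-D) * (1 / 4) ^ k) *
            (1 / 2) ^ (n - k) := by gcongr
      _ = X * ((1 / 4) ^ k * (1 / 2) ^ (n - k)) := by rw [hX]; ring
  have hexp : ∑ j ∈ Finset.range (D + 1), (c j : ℂ) *
      p.partialSum N (w - ((s * v j : ℝ) : ℂ) • Y) - p.partialSum N w =
      ∑ n ∈ Finset.range N, (∑ j ∈ Finset.range (D + 1), (c j : ℂ) *
      (p n fun _ => w - ((s * v j : ℝ) : ℂ) • Y) - p n fun _ => w) := by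
    simp only [FormalMultilinearSeries.partialSum, Finset.mul_sum]
    rw [Finset.sum_comm, Finset.sum_sub_distrib]
  rw [hexp]
  refine (norm_sum_le_of_le _ fun n hn => hterm n (Finset.mem_range.1 hn)).trans ?_
  rw [← Finset.mul_sum]
  have hgeo : ∑ n ∈ Finset.range N, (3 / 4 : ℝ) ^ n ≤ 4 := by
    refine ((summable_geometric_of_lt_one (by norm_num) (by norm_num)).sum_le_tsum _
      fun _ _ => by positivity).trans_eq ?_
    rw [tsum_geometric_of_lt_one (by norm_num) (by norm_num)]; norm_num
  calc X * ∑ n ∈ Finset.range N, (3 / 4 : ℝ) ^ n ≤ X * 4 := by gcongr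
    _ = _ := by rw [hX]; ring

end Extrapolation

/-! ### The regularization near a point, compared with a Taylor polynomial. -/

section Approximation

variable {d : ℕ} {p : FormalMultilinearSeries ℂ (EuclideanSpace ℂ (Fin d)) ℂ} {M κ : ℝ}

/-- The regularization of `φ` by an extrapolated combination of Gaussians. -/
noncomputable def gaussRegularization (D : ℕ) (v c : ℕ → ℝ) (s : ℝ)
    (φ : EuclideanSpace ℝ (Fin d) → ℂ) (w : EuclideanSpace ℂ (Fin d)) : ℂ :=
  ∑ j ∈ Finset.range (D + 1), (c j : ℂ) *
    ∫ u, φ u * gaussKernel (s * v j) (w - realToComplex u)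

theorem norm_gaussKernel_le {s σ : ℝ} (hs : 0 < s) (hσ : s ≤ σ) (w : EuclideanSpace ℂ (Fin d))
    (u : EuclideanSpace ℝ (Fin d)) : ‖gaussKernel σ (w - realToComplex u)‖ ≤
      (s ^ d)⁻¹ * Real.exp (Real.pi / s ^ 2 * ‖w‖ ^ 2) := by
  have hσ0 := hs.trans_le hσ
  refine (norm_gaussKernel_sub_le hσ0 w u).trans ?_
  have h1 : Real.pi / σ ^ 2 * (‖w‖ ^ 2 - ‖u‖ ^ 2 / 2) ≤ Real.pi / s ^ 2 * ‖w‖ ^ 2 := by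
    calc _ ≤ Real.pi / σ ^ 2 * ‖w‖ ^ 2 := by
          gcongr; linarith [sq_nonneg ‖u‖]
      _ ≤ _ := by gcongr
  gcongr

/-- Once ‖u‖ ≥ 2‖w‖, the exponent ‖w‖² - ‖u‖²/2 is at most -‖u‖²/4; the other factor 4 in 16 comes
from σ² ≤ 4s². -/
theorem norm_gaussKernel_le_of_le {s σ : ℝ} (hs : 0 < s) (hσ : s ≤ σ) (hσ2 : σ ≤ 2 * s)
    {w : EuclideanSpace ℂ (Fin d)} {u : EuclideanSpace ℝ (Fin d)} (hu : 2 * ‖w‖ ≤ ‖u‖) :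
    ‖gaussKernel σ (w - realToComplex u)‖ ≤
      (s ^ d)⁻¹ * Real.exp (-(Real.pi / (16 * s ^ 2) * ‖u‖ ^ 2)) := by
  have hσ0 := hs.trans_le hσ
  refine (norm_gaussKernel_sub_le hσ0 w u).trans ?_
  have h1 : Real.pi / σ ^ 2 * (‖w‖ ^ 2 - ‖u‖ ^ 2 / 2) ≤ -(Real.pi / (16 * s ^ 2) * ‖u‖ ^ 2) := by
    have h2 : ‖w‖ ^ 2 - ‖u‖ ^ 2 / 2 ≤ -(‖u‖ ^ 2 / 4) := by
      nlinarith [norm_nonneg w]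
    have h3 : Real.pi / (4 * s ^ 2) ≤ Real.pi / σ ^ 2 := by
      gcongr
      nlinarith
    calc Real.pi / σ ^ 2 * (‖w‖ ^ 2 - ‖u‖ ^ 2 / 2) ≤ Real.pi / σ ^ 2 * -(‖u‖ ^ 2 / 4) := by gcongr
      _ ≤ -(Real.pi / (4 * s ^ 2) * (‖u‖ ^ 2 / 4)) := by
          rw [mul_neg, neg_le_neg_iff]; gcongr
      _ = _ := by field_simp; ring
  gcongr

theorem integrable_mul_gaussKernel {φ : EuclideanSpace ℝ (Fin d) → ℂ} (hφ : Integrable φ)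
    {σ : ℝ} (hσ : 0 < σ) (w : EuclideanSpace ℂ (Fin d)) :
    Integrable fun u => φ u * gaussKernel σ (w - realToComplex u) := by
  have hc := (differentiable_gaussKernel (d := d) σ).continuous
  refine hφ.mul_bdd (c := (σ ^ d)⁻¹ * Real.exp (Real.pi / σ ^ 2 * ‖w‖ ^ 2))
    (Continuous.aestronglyMeasurable (by fun_prop)) (ae_of_all _ fun u => ?_)
  exact norm_gaussKernel_le hσ le_rfl w u

theorem differentiable_gaussRegularization {D : ℕ} {v c : ℕ → ℝ} (h : IsExtrapolation D v c)
    {s : ℝ} (hs : 0 < s) {φ : EuclideanSpace ℝ (Fin d) → ℂ} (hφ : Integrable φ) :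
    Differentiable ℂ (gaussRegularization D v c s φ) := by
  refine Differentiable.fun_sum fun j hj => (differentiable_const _).mul fun w₀ => ?_
  have hσ : 0 < s * v j := mul_pos hs (by linarith [(h.mem_Icc j hj).1])
  have hG := differentiable_gaussKernel (d := d) (s * v j)
  refine differentiableAt_integral_of_dominated one_pos (bound := fun u => ‖φ u‖ *
    (((s * v j) ^ d)⁻¹ * Real.exp (Real.pi / (s * v j) ^ 2 * (‖w₀‖ + 1) ^ 2)))
    (hφ.norm.mul_const _) (fun w _ => (integrable_mul_gaussKernel hφ hσ w).1) (fun u => ?_) ?_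
  · refine Differentiable.differentiableOn ((differentiable_const _).mul (hG.comp ?_))
    fun_prop
  · intro w hw u
    rw [norm_mul]
    have h1 : ‖w‖ ≤ ‖w₀‖ + 1 := by
      rw [mem_ball, dist_eq_norm] at hw
      linarith [norm_sub_norm_le w w₀]
    refine mul_le_mul_of_nonneg_left ((norm_gaussKernel_le hσ le_rfl w u).trans ?_) (norm_nonneg _)
    gcongr

theorem gaussRegularization_translate (D : ℕ) (v c : ℕ → ℝ) (s : ℝ)
    (φ : EuclideanSpace ℝ (Fin d) → ℂ) (x : EuclideanSpace ℝ (Fin d))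
    (z : EuclideanSpace ℂ (Fin d)) :
    gaussRegularization D v c s φ z =
      gaussRegularization D v c s (fun u => φ (x + u)) (z - realToComplex x) := by
  refine Finset.sum_congr rfl fun j _ => ?_
  rw [← integral_add_left_eq_self _ x]
  have : ∀ u, realToComplex (x + u) = realToComplex x + realToComplex u :=
    (realToComplexₗᵢ d).map_add x
  simp only [this, sub_sub]

/-- The regularization of a function which is close to a polynomial near `0` is close to that
polynomial in a complex neighbourhood of `0`. -/
theorem norm_gaussRegularization_sub_le {D N : ℕ} {v c : ℕ → ℝ} (h : IsExtrapolation D v c)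
    (hM : 0 ≤ M) (hκ : 0 < κ) (hp : ∀ n, ‖p n‖ ≤ M * κ ^ n) {s ρ ν : ℝ} (hs : 0 < s) (hs1 : s ≤ 1)
    (hρ : 0 < ρ) (hν : 0 ≤ ν) {φ : EuclideanSpace ℝ (Fin d) → ℂ} (hφ : Integrable φ)
    (hφν : ∀ u, ‖u‖ < ρ → ‖φ u - p.partialSum N (realToComplex u)‖ ≤ ν)
    (hN : (2 * s * κ) ^ 2 * Real.exp 14 * N ≤ 3) (hN2 : N * κ * (16 * s ^ 2) ≤ ρ)
    {w : EuclideanSpace ℂ (Fin d)} (hw : κ * ‖w‖ ≤ 1 / 2) (hwρ : 2 * ‖w‖ ≤ ρ) :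
    ‖gaussRegularization D v c s φ w - p.partialSum N w‖ ≤
      Real.exp (4 * D) * (s ^ d)⁻¹ * (ν * Real.exp (Real.pi / s ^ 2 * ‖w‖ ^ 2) *
          volume.real (ball (0 : EuclideanSpace ℝ (Fin d)) ρ) +
        (∫ u, ‖φ u‖) * Real.exp (-(ρ ^ 2 / (16 * s ^ 2))) +
        M * Real.exp (-(ρ ^ 2 / (16 * s ^ 2))) *
          ∫ u : EuclideanSpace ℝ (Fin d), Real.exp (-(1 / 16) * ‖u‖ ^ 2)) +
      4 * M * Real.exp (-D) *
        ∫ u : EuclideanSpace ℝ (Fin d), Real.exp (-(Real.pi / 2) * ‖u‖ ^ 2) := by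
  have hPd := differentiable_partialSum p N
  have hPle := norm_partialSum_le_exp hM hκ.le hp N
  have hPc := hPd.continuous
  set P := p.partialSum N
  have hv0 : ∀ j ∈ Finset.range (D + 1), s ≤ s * v j ∧ s * v j ≤ 2 * s := fun j hj => by
    have := h.mem_Icc j hj
    constructor <;> nlinarith [this.1, this.2]
  -- Three contributions: the error ν inside the ball, and outside it φ and the polynomial
  -- separately.
  set bound : EuclideanSpace ℝ (Fin d) → ℝ := fun u => (s ^ d)⁻¹ *
    ((ball (0 : EuclideanSpace ℝ (Fin d)) ρ).indicator
        (fun _ => ν * Real.exp (Real.pi / s ^ 2 * ‖w‖ ^ 2)) u +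
      ‖φ u‖ * Real.exp (-(ρ ^ 2 / (16 * s ^ 2))) +
      M * Real.exp (-(ρ ^ 2 / (16 * s ^ 2))) * Real.exp (-(1 / 16) * ‖u‖ ^ 2)) with hbound
  have hi1 : Integrable ((ball (0 : EuclideanSpace ℝ (Fin d)) ρ).indicator
        (fun _ => ν * Real.exp (Real.pi / s ^ 2 * ‖w‖ ^ 2))) :=
    (integrable_indicator_iff measurableSet_ball).2
      (integrableOn_const measure_ball_lt_top.ne)
  have hi2 : Integrable fun u => ‖φ u‖ * Real.exp (-(ρ ^ 2 / (16 * s ^ 2))) :=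
    hφ.norm.mul_const _
  have hi3 : Integrable fun u : EuclideanSpace ℝ (Fin d) =>
      M * Real.exp (-(ρ ^ 2 / (16 * s ^ 2))) * Real.exp (-(1 / 16) * ‖u‖ ^ 2) :=
    (integrable_exp_neg_mul_sq_norm (by norm_num)).const_mul _
  have hbi : Integrable bound := ((hi1.add hi2).add hi3).const_mul _
  have hint : ∫ u, bound u = (s ^ d)⁻¹ * (ν * Real.exp (Real.pi / s ^ 2 * ‖w‖ ^ 2) *
          volume.real (ball (0 : EuclideanSpace ℝ (Fin d)) ρ) +
        (∫ u, ‖φ u‖) * Real.exp (-(ρ ^ 2 / (16 * s ^ 2))) +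
        M * Real.exp (-(ρ ^ 2 / (16 * s ^ 2))) *
          ∫ u : EuclideanSpace ℝ (Fin d), Real.exp (-(1 / 16) * ‖u‖ ^ 2)) := by
    simp only [hbound]
    rw [integral_const_mul, integral_add (by exact hi1.add hi2) hi3, integral_add hi1 hi2,
      integral_indicator measurableSet_ball, setIntegral_const, integral_mul_const,
      integral_const_mul, smul_eq_mul, mul_comm (volume.real _)]
  have hpt : ∀ j ∈ Finset.range (D + 1), ∀ u,
      ‖(φ u - P (realToComplex u)) * gaussKernel (s * v j) (w - realToComplex u)‖ ≤ bound u := by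
    intro j hj u
    obtain ⟨hj1, hj2⟩ := hv0 j hj
    rw [norm_mul]
    simp only [hbound]
    by_cases hu : ‖u‖ < ρ
    · have hu' : u ∈ ball (0 : EuclideanSpace ℝ (Fin d)) ρ := by simpa using hu
      rw [indicator_of_mem hu']
      calc _ ≤ ν * ((s ^ d)⁻¹ * Real.exp (Real.pi / s ^ 2 * ‖w‖ ^ 2)) :=
            mul_le_mul (hφν u hu) (norm_gaussKernel_le hs hj1 w u) (norm_nonneg _) hν
        _ = (s ^ d)⁻¹ * (ν * Real.exp (Real.pi / s ^ 2 * ‖w‖ ^ 2)) := by ring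
        _ ≤ _ := by
            refine mul_le_mul_of_nonneg_left ?_ (by positivity)
            rw [add_assoc]
            exact le_add_of_nonneg_right (by positivity)
    · have hu' : u ∉ ball (0 : EuclideanSpace ℝ (Fin d)) ρ := by simpa using hu
      rw [not_lt] at hu
      rw [indicator_of_notMem hu', zero_add]
      have hG := norm_gaussKernel_le_of_le hs hj1 hj2 (w := w) (u := u) (hwρ.trans hu)
      have hPu := hPle (realToComplex u)
      rw [norm_realToComplex] at hPu
      have hs2 : 0 < 16 * s ^ 2 := by positivity
      have hρu : ρ ^ 2 ≤ ‖u‖ ^ 2 := pow_le_pow_left₀ hρ.le hu 2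
      have hE1 : Real.exp (-(Real.pi / (16 * s ^ 2) * ‖u‖ ^ 2)) ≤
          Real.exp (-(ρ ^ 2 / (16 * s ^ 2))) := by
        refine Real.exp_le_exp.2 (neg_le_neg ?_)
        rw [div_mul_eq_mul_div]
        gcongr
        nlinarith [Real.pi_gt_three, sq_nonneg ‖u‖]
      -- As π > 3, the exponent contains three copies of ‖u‖²/(16s²): one absorbs the growth of the
      -- polynomial, one gives smallness, one keeps the integral finite.
      have hE2 : Real.exp (N * κ * ‖u‖) * Real.exp (-(Real.pi / (16 * s ^ 2) * ‖u‖ ^ 2)) ≤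
          Real.exp (-(ρ ^ 2 / (16 * s ^ 2))) * Real.exp (-(1 / 16) * ‖u‖ ^ 2) := by
        rw [← Real.exp_add, ← Real.exp_add]
        refine Real.exp_le_exp.2 ?_
        have e1 : N * κ * ‖u‖ ≤ ‖u‖ ^ 2 / (16 * s ^ 2) := by
          rw [le_div_iff₀ hs2]
          nlinarith [norm_nonneg u]
        have e2 : ρ ^ 2 / (16 * s ^ 2) ≤ ‖u‖ ^ 2 / (16 * s ^ 2) := by gcongr
        have e3 : 1 / 16 * ‖u‖ ^ 2 ≤ ‖u‖ ^ 2 / (16 * s ^ 2) := by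
          rw [le_div_iff₀ hs2]
          have : s ^ 2 ≤ 1 := pow_le_one₀ hs.le hs1
          nlinarith [sq_nonneg ‖u‖]
        have e4 : 3 * (‖u‖ ^ 2 / (16 * s ^ 2)) ≤ Real.pi / (16 * s ^ 2) * ‖u‖ ^ 2 := by
          rw [div_mul_eq_mul_div, ← mul_div_assoc]
          gcongr
          exact Real.pi_gt_three.le
        linarith
      calc _ ≤ (‖φ u‖ + M * Real.exp (N * κ * ‖u‖)) *
            ((s ^ d)⁻¹ * Real.exp (-(Real.pi / (16 * s ^ 2) * ‖u‖ ^ 2))) :=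
            mul_le_mul ((norm_sub_le _ _).trans (add_le_add_right hPu _)) hG (norm_nonneg _)
              (by positivity)
        _ = (s ^ d)⁻¹ * (‖φ u‖ * Real.exp (-(Real.pi / (16 * s ^ 2) * ‖u‖ ^ 2)) +
            M * (Real.exp (N * κ * ‖u‖) * Real.exp (-(Real.pi / (16 * s ^ 2) * ‖u‖ ^ 2)))) := by
            ring
        _ ≤ (s ^ d)⁻¹ * (‖φ u‖ * Real.exp (-(ρ ^ 2 / (16 * s ^ 2))) +
            M * (Real.exp (-(ρ ^ 2 / (16 * s ^ 2))) * Real.exp (-(1 / 16) * ‖u‖ ^ 2))) := by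
            gcongr
        _ = _ := by ring
  -- integrability of the polynomial part
  have hPi : ∀ j ∈ Finset.range (D + 1), Integrable fun u : EuclideanSpace ℝ (Fin d) =>
      P (realToComplex u) * gaussKernel (s * v j) (w - realToComplex u) := by
    intro j hj
    have hc := (differentiable_gaussKernel (d := d) (s * v j)).continuous
    have hφi := integrable_mul_gaussKernel hφ (hs.trans_le (hv0 j hj).1) w
    have := (hbi.mono' (Continuous.aestronglyMeasurable
      (f := fun u => P (realToComplex u) * gaussKernel (s * v j) (w - realToComplex u))
      (by fun_prop) |> hφi.1.sub) (ae_of_all _ fun u => ?_))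
    · refine (hφi.sub this).congr (ae_of_all _ fun u => ?_)
      simp
    · have := hpt j hj u
      rwa [sub_mul] at this
  have hPG : ∀ j ∈ Finset.range (D + 1), Integrable fun y : EuclideanSpace ℝ (Fin d) =>
      P (w - ((s * v j : ℝ) : ℂ) • realToComplex y) * (Real.exp (-Real.pi * ‖y‖ ^ 2) : ℝ) := by
    intro j hj
    have hσ : 0 < s * v j := hs.trans_le (hv0 j hj).1
    refine ((integrable_exp_mul_norm_mul_exp_neg_mul_sq_norm (d := d) (N * κ * (s * v j))
      Real.pi_pos).const_mul (M * Real.exp (N * κ * ‖w‖))).mono'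
      (Continuous.aestronglyMeasurable (by fun_prop)) (ae_of_all _ fun y => ?_)
    rw [norm_mul, Complex.norm_real, Real.norm_of_nonneg (Real.exp_pos _).le, ← mul_assoc]
    refine mul_le_mul_of_nonneg_right ((hPle _).trans ?_) (Real.exp_pos _).le
    rw [mul_assoc M, ← Real.exp_add]
    have : ‖w - ((s * v j : ℝ) : ℂ) • realToComplex y‖ ≤ ‖w‖ + s * v j * ‖y‖ := by
      refine (norm_sub_le _ _).trans ?_
      rw [norm_smul, norm_realToComplex, Complex.norm_real, Real.norm_of_nonneg hσ.le]
    have h2 : N * κ * ‖w - ((s * v j : ℝ) : ℂ) • realToComplex y‖ ≤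
        N * κ * (‖w‖ + s * v j * ‖y‖) := by gcongr
    gcongr
    linarith
  -- Write φ = (φ - P) + P. On P the convolution formula moves the complex point into P and leaves
  -- the extrapolation error against a fixed Gaussian.
  have hsplit : gaussRegularization D v c s φ w - P w =
      (∑ j ∈ Finset.range (D + 1), (c j : ℂ) *
        ∫ u, (φ u - P (realToComplex u)) * gaussKernel (s * v j) (w - realToComplex u)) +
      ∫ y : EuclideanSpace ℝ (Fin d), (∑ j ∈ Finset.range (D + 1), (c j : ℂ) *
        P (w - ((s * v j : ℝ) : ℂ) • realToComplex y) - P w) *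
          (Real.exp (-Real.pi * ‖y‖ ^ 2) : ℝ) := by
    have hP1 : ∫ y : EuclideanSpace ℝ (Fin d), P w * (Real.exp (-Real.pi * ‖y‖ ^ 2) : ℝ) = P w := by
      rw [integral_const_mul, integral_complex_ofReal, integral_exp_neg_pi_mul_sq_norm]
      simp
    have e1 : ∫ y : EuclideanSpace ℝ (Fin d), (∑ j ∈ Finset.range (D + 1), (c j : ℂ) *
        P (w - ((s * v j : ℝ) : ℂ) • realToComplex y) - P w) *
          (Real.exp (-Real.pi * ‖y‖ ^ 2) : ℝ) =
        ∑ j ∈ Finset.range (D + 1), (c j : ℂ) *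
          (∫ u, P (realToComplex u) * gaussKernel (s * v j) (w - realToComplex u)) - P w := by
      simp only [sub_mul, Finset.sum_mul, mul_assoc]
      rw [integral_sub, integral_finsetSum, hP1]
      · congr 1
        refine Finset.sum_congr rfl fun j hj => ?_
        rw [integral_const_mul, integral_mul_gaussKernel_sub hPd hM (by positivity) hPle
          (hs.trans_le (hv0 j hj).1)]
      · exact fun j hj => (hPG j hj).const_mul _
      · exact integrable_finsetSum _ fun j hj => (hPG j hj).const_mul _
      · exact ((integrable_exp_neg_mul_sq_norm Real.pi_pos).ofReal (𝕜 := ℂ)).const_mul _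
    rw [e1, gaussRegularization, ← add_sub_assoc, ← Finset.sum_add_distrib]
    congr 1
    refine Finset.sum_congr rfl fun j hj => ?_
    rw [← mul_add, ← integral_add _ (hPi j hj)]
    · congr 2; ext u; ring
    · have := (integrable_mul_gaussKernel hφ (hs.trans_le (hv0 j hj).1) w).sub (hPi j hj)
      refine this.congr (ae_of_all _ fun u => ?_)
      simp [sub_mul]
  rw [hsplit]
  refine (norm_add_le _ _).trans (add_le_add ?_ ?_)
  · refine (norm_sum_le_of_le (n := fun j => |c j| * ∫ u, bound u) _ fun j hj => ?_).trans ?_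
    · rw [norm_mul, Complex.norm_real, Real.norm_eq_abs]
      exact mul_le_mul_of_nonneg_left
        (norm_integral_le_of_norm_le hbi (ae_of_all _ (hpt j hj))) (abs_nonneg _)
    · rw [← Finset.sum_mul, mul_assoc, ← hint]
      refine mul_le_mul_of_nonneg_right h.sum_abs_le (integral_nonneg fun u => ?_)
      exact (norm_nonneg _).trans (hpt 0 (by simp) u)
  · rw [← integral_const_mul]
    refine norm_integral_le_of_norm_le
      ((integrable_exp_neg_mul_sq_norm (by positivity)).const_mul _) (ae_of_all _ fun y => ?_)
    rw [norm_mul, Complex.norm_real, Real.norm_of_nonneg (Real.exp_pos _).le]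
    have := h.norm_sub_partialSum_le hM hκ hp hw hs hN (realToComplex y)
    rw [norm_realToComplex] at this
    refine (mul_le_mul_of_nonneg_right this (Real.exp_pos _).le).trans_eq ?_
    rw [mul_assoc, ← Real.exp_add]
    congr 2
    ring

end Approximation

/-! ### Balancing the exponents. -/

section Asymptotics

variable {d : ℕ}

theorem half_pow_floor_le (t : ℝ) :
    (1 / 2 : ℝ) ^ ⌊t⌋₊ ≤ 2 * Real.exp (-(t / 2)) := by
  have h1 : (1 / 2 : ℝ) ≤ Real.exp (-(1 / 2)) := by
    linarith [Real.add_one_le_exp (-(1 / 2) : ℝ)]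
  have h2 : Real.exp (1 / 2) ≤ 2 := by
    rw [Real.exp_neg, one_div, inv_le_inv₀ (by norm_num) (Real.exp_pos _)] at h1
    rwa [one_div]
  calc (1 / 2 : ℝ) ^ ⌊t⌋₊ ≤ Real.exp (-(1 / 2)) ^ ⌊t⌋₊ := pow_le_pow_left₀ (by norm_num) h1 _
    _ = Real.exp (⌊t⌋₊ * (-(1 / 2))) := (Real.exp_nat_mul _ _).symm
    _ ≤ Real.exp (1 / 2 + -(t / 2)) := Real.exp_le_exp.2 (by linarith [Nat.lt_floor_add_one t])
    _ = Real.exp (1 / 2) * Real.exp (-(t / 2)) := Real.exp_add _ _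
    _ ≤ _ := by gcongr

/-- With `L = log (1 / ε)` and a large parameter `A`, the regularization at scale
`s = 1 / (A √L)` of a function which is close to a moderate convergent power series is close to
the sum of that series, in a complex ball which does not depend on `A` and `L`. -/
theorem exists_norm_gaussRegularization_sub_sum_le (d : ℕ) {κ ρ η a : ℝ} (hκ : 0 < κ)
    (hρ : 0 < ρ) (hη : 0 < η) (ha : 0 < a) : ∃ h : ℝ, 0 < h ∧ h ≤ ρ ∧ κ * h ≤ 1 / 2 ∧
    ∀ b : ℝ, ∃ R C : ℝ, ∀ A L : ℝ, R ≤ A → 1 ≤ L → ∀ (D : ℕ) (v c : ℕ → ℝ),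
      IsExtrapolation D v c → A * L ≤ D → D ≤ A * L + 1 →
      ∀ (p : FormalMultilinearSeries ℂ (EuclideanSpace ℂ (Fin d)) ℂ)
        (φ g : EuclideanSpace ℝ (Fin d) → ℂ),
      (∀ n, ‖p n‖ ≤ η * Real.exp (a * L) * κ ^ n) → Integrable φ →
      ∫ u, ‖φ u‖ ≤ Real.exp (A * L) → (∀ u, ‖u‖ < ρ → ‖φ u - g u‖ ≤ Real.exp (-(A ^ 3 * L))) →
      (∀ u, ‖u‖ < ρ → ∀ n, ‖g u - p.partialSum (n + 1) (realToComplex u)‖ ≤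
        η * Real.exp (a * L) * (1 / 2) ^ (n + 1)) →
      ∀ w, ‖w‖ ≤ h → ‖gaussRegularization D v c (A * √L)⁻¹ φ w - p.sum w‖ ≤
        C * Real.exp (-(b * L)) := by
  -- The two bounds are what the degree N = ⌊c₀ T⌋ needs in `hN3` and `hN4`, with T = 1/s².
  set c₀ : ℝ := min (3 / (4 * κ ^ 2 * Real.exp 14)) (ρ / (16 * κ)) with hc₀
  have hc₀pos : 0 < c₀ := lt_min (by positivity) (by positivity)
  -- δ T is the unit for the costs: weights and normalization together cost at most 2δT, the factor
  -- M at most δT up to η, while c₀T and ρ²T are at least 64δT.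
  set δ : ℝ := min c₀ (ρ ^ 2) / 64 with hδ
  have hδpos : 0 < δ := div_pos (lt_min hc₀pos (by positivity)) (by norm_num)
  have hδ1 : 64 * δ ≤ c₀ := by rw [hδ]; linarith [min_le_left c₀ (ρ ^ 2)]
  have hδ2 : 64 * δ ≤ ρ ^ 2 := by rw [hδ]; linarith [min_le_right c₀ (ρ ^ 2)]
  -- The last entry limits the cost πTh² of the complex shift to c₀T/4, half of the gain c₀T/2 from
  -- truncation.
  set h : ℝ := min (min (ρ / 2) (1 / (2 * κ))) (√c₀ / 4) with hh
  have hh1 : h ≤ ρ / 2 := (min_le_left _ _).trans (min_le_left _ _)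
  have hh2 : κ * h ≤ 1 / 2 := by
    have : h ≤ 1 / (2 * κ) := (min_le_left _ _).trans (min_le_right _ _)
    calc κ * h ≤ κ * (1 / (2 * κ)) := by gcongr
      _ = 1 / 2 := by field_simp
  have hhpos : 0 < h := lt_min (lt_min (by positivity) (by positivity)) (by positivity)
  have hh3 : Real.pi * h ^ 2 ≤ c₀ / 4 := by
    have h1 : h ^ 2 ≤ (√c₀ / 4) ^ 2 := pow_le_pow_left₀ hhpos.le (min_le_right _ _) 2
    rw [div_pow, Real.sq_sqrt hc₀pos.le] at h1
    nlinarith [Real.pi_lt_four, Real.pi_pos, sq_nonneg h]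
  set V := volume.real (ball (0 : EuclideanSpace ℝ (Fin d)) ρ)
  set C₁ := ∫ u : EuclideanSpace ℝ (Fin d), Real.exp (-(1 / 16) * ‖u‖ ^ 2)
  set C₂ := ∫ u : EuclideanSpace ℝ (Fin d), Real.exp (-(Real.pi / 2) * ‖u‖ ^ 2)
  have hC₁ : 0 ≤ C₁ := integral_nonneg fun u => (Real.exp_pos _).le
  have hC₂ : 0 ≤ C₂ := integral_nonneg fun u => (Real.exp_pos _).le
  have hV : 0 ≤ V := measureReal_nonneg
  refine ⟨h, hhpos, by linarith, hh2, fun b => ?_⟩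
  -- Each summand secures one of the lower bounds on A, among them `q1` to `q7`; only this threshold
  -- depends on b.
  refine ⟨1 + 8 / δ + d / δ + a / δ + |b| / δ + c₀ + a + |b| + 1 / c₀,
    (1 + 2 * η) * V + 1 + η * C₁ + 4 * η * C₂ + 4 * η, ?_⟩
  intro A L hA hL D v c hext hD1 hD2 p φ g hp hφ hS hν hg w hw
  have hRpos : ∀ x : ℝ, 0 ≤ x → 0 ≤ x / δ := fun x hx => by positivity
  have p1 := hRpos 8 (by norm_num)
  have p2 := hRpos d (by positivity)
  have p3 := hRpos a ha.le
  have p4 := hRpos |b| (abs_nonneg b)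
  have p5 : 0 ≤ 1 / c₀ := by positivity
  have p6 := abs_nonneg b
  have hA1 : 1 ≤ A := by linarith
  have hdiv : ∀ x : ℝ, x / δ ≤ A → x ≤ δ * A := fun x hx => by
    rwa [div_le_iff₀ hδpos, mul_comm] at hx
  have q1 : 8 ≤ δ * A := hdiv 8 (by linarith)
  have q2 : d ≤ δ * A := hdiv d (by linarith)
  have q3 : a ≤ δ * A := hdiv a (by linarith)
  have q4 : |b| ≤ δ * A := hdiv |b| (by linarith)
  have q5 : c₀ ≤ A := by linarith
  have q6 : a + |b| ≤ A := by linarith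
  have q7 : 1 ≤ c₀ * A := by
    have : 1 / c₀ ≤ A := by linarith
    rwa [div_le_iff₀ hc₀pos, mul_comm] at this
  have hL0 : 0 < L := by linarith
  have hA0 : 0 < A := by linarith
  have hsqrt : 1 ≤ √L := Real.one_le_sqrt.2 hL
  set y := A * √L with hy
  have hAy : A ≤ y := le_mul_of_one_le_right hA0.le hsqrt
  have hy1 : 1 ≤ y := hA1.trans hAy
  have hy0 : 0 < y := by linarith
  have hT : y ^ 2 = A ^ 2 * L := by rw [hy, mul_pow, Real.sq_sqrt hL0.le]
  set T := y ^ 2 with hTdef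
  have hAT : A * L ≤ T := by
    rw [hT, sq, mul_assoc]; exact le_mul_of_one_le_left (by positivity) hA1
  have hδT : ∀ x, x ≤ δ * A → x * (A * L) ≤ δ * T := fun x hx => by
    rw [hT]
    calc x * (A * L) ≤ δ * A * (A * L) := by gcongr
      _ = _ := by ring
  have hLAL : L ≤ A * L := le_mul_of_one_le_left hL0.le hA1
  have hT1 : 1 ≤ T := one_le_pow₀ hy1
  have hT0 : 0 < T := by linarith
  have t1 : 4 * (D : ℝ) ≤ δ * T := by
    have := hδT 8 q1
    linarith
  have t2 : a * L ≤ δ * T := (mul_le_mul_of_nonneg_left hLAL ha.le).trans (hδT a q3)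
  have t3 : b * L ≤ δ * T := by
    refine le_trans ?_ (hδT |b| q4)
    calc b * L ≤ |b| * L := by gcongr; exact le_abs_self b
      _ ≤ _ := by gcongr
  have t4 : A * L ≤ δ * T := by
    have := hδT 8 q1
    linarith [mul_pos hA0 hL0]
  have t5 : c₀ * T ≤ A ^ 3 * L := by
    rw [hT]
    calc c₀ * (A ^ 2 * L) ≤ A * (A ^ 2 * L) := by gcongr
      _ = _ := by ring
  -- The extrapolation error is of size exp(aL - D), so D ≥ AL with A ≥ a + |b| is what makes it
  -- O(ε^b).
  have t6 : a * L - D ≤ -(b * L) := by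
    have h1 : (a + |b|) * L ≤ A * L := by gcongr
    have h2 : b * L ≤ |b| * L := by gcongr; exact le_abs_self b
    linarith
  have t7 : 1 ≤ c₀ * T := by
    have h1 : A ≤ T := hAy.trans (le_self_pow₀ hy1 two_ne_zero)
    calc 1 ≤ c₀ * A := q7
      _ ≤ c₀ * T := by gcongr
  have t8 : y ^ d ≤ Real.exp (δ * T) := by
    calc y ^ d ≤ Real.exp y ^ d :=
          pow_le_pow_left₀ hy0.le (by linarith [Real.add_one_le_exp y]) d
      _ = Real.exp (d * y) := (Real.exp_nat_mul _ _).symm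
      _ ≤ Real.exp (δ * T) := Real.exp_le_exp.2 ((mul_le_mul_of_nonneg_right
          (q2.trans (mul_le_mul_of_nonneg_left hAy hδpos.le)) hy0.le).trans_eq (by
            rw [hTdef]; ring))
  set M := η * Real.exp (a * L) with hM
  have hMpos : 0 ≤ M := by positivity
  have hMle : M ≤ η * Real.exp (δ * T) := by
    rw [hM]; gcongr
  set N := ⌊c₀ * T⌋₊ with hN
  have hN1 : 1 ≤ N := (Nat.one_le_floor_iff _).2 t7
  have hNle : (N : ℝ) ≤ c₀ * T := Nat.floor_le (by positivity)
  have hhalf : (1 / 2 : ℝ) ^ N ≤ 2 * Real.exp (-(c₀ * T / 2)) := half_pow_floor_le _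
  set s := y⁻¹ with hs
  have hspos : 0 < s := by positivity
  have hs1 : s ≤ 1 := inv_le_one_of_one_le₀ hy1
  have hsT : s ^ 2 * T = 1 := by rw [hs, hTdef]; field_simp
  have hdivs : ∀ x : ℝ, x / s ^ 2 = x * T := fun x => by
    rw [hs, hTdef]; field_simp
  have hN3 : (2 * s * κ) ^ 2 * Real.exp 14 * N ≤ 3 := by
    have h1 : c₀ ≤ 3 / (4 * κ ^ 2 * Real.exp 14) := min_le_left _ _
    rw [le_div_iff₀ (by positivity)] at h1
    calc (2 * s * κ) ^ 2 * Real.exp 14 * N ≤ (2 * s * κ) ^ 2 * Real.exp 14 * (c₀ * T) := by gcongr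
      _ = (s ^ 2 * T) * (c₀ * (4 * κ ^ 2 * Real.exp 14)) := by ring
      _ ≤ 3 := by rw [hsT, one_mul]; exact h1
  have hN4 : N * κ * (16 * s ^ 2) ≤ ρ := by
    have h1 : c₀ ≤ ρ / (16 * κ) := min_le_right _ _
    rw [le_div_iff₀ (by positivity)] at h1
    calc N * κ * (16 * s ^ 2) ≤ c₀ * T * κ * (16 * s ^ 2) := by gcongr
      _ = (s ^ 2 * T) * (c₀ * (16 * κ)) := by ring
      _ ≤ ρ := by rw [hsT, one_mul]; exact h1
  have hwκ : κ * ‖w‖ ≤ 1 / 2 := le_trans (by gcongr) hh2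
  have hnear : ∀ u, ‖u‖ < ρ → ‖φ u - p.partialSum N (realToComplex u)‖ ≤
      Real.exp (-(A ^ 3 * L)) + M * (1 / 2) ^ N := by
    intro u hu
    obtain ⟨n, hn⟩ := Nat.exists_eq_succ_of_ne_zero (Nat.one_le_iff_ne_zero.1 hN1)
    have h2 := hg u hu n
    rw [hn]
    calc _ = ‖(φ u - g u) + (g u - p.partialSum (n + 1) (realToComplex u))‖ := by
          congr 1; simp
      _ ≤ _ := (norm_add_le _ _).trans (add_le_add (hν u hu) h2)
  have key := norm_gaussRegularization_sub_le hext hMpos hκ hp hspos hs1 hρ (by positivity) hφ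
    hnear hN3 hN4 hwκ (by linarith)
  have key2 := norm_sum_sub_partialSum_le hMpos hp hκ hwκ N
  have hsd : (s ^ d)⁻¹ = y ^ d := by rw [hs, inv_pow, inv_inv]
  rw [hsd, hdivs, mul_comm 16 (s ^ 2), ← div_div (ρ ^ 2), hdivs] at key
  -- the elementary factors
  have hδT64 : 64 * (δ * T) ≤ c₀ * T := by rw [← mul_assoc]; gcongr
  have hρT64 : 64 * (δ * T) ≤ ρ ^ 2 * T := by rw [← mul_assoc]; gcongr
  have hδT0 : 0 < δ * T := by positivity
  have hEb : Real.exp (-(δ * T)) ≤ Real.exp (-(b * L)) := Real.exp_le_exp.2 (by linarith)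
  have f1 : Real.exp (4 * D) * y ^ d ≤ Real.exp (2 * (δ * T)) := by
    rw [two_mul, Real.exp_add]
    gcongr
  have f2 : (Real.exp (-(A ^ 3 * L)) + M * (1 / 2) ^ N) * Real.exp (Real.pi * T * ‖w‖ ^ 2) ≤
      (1 + 2 * η) * Real.exp (-(3 * (δ * T))) := by
    -- The exponent A³L dominates T = A²L, so the distance from φ to g is as harmless as the
    -- truncation error.
    have e1 : Real.exp (-(A ^ 3 * L)) ≤ Real.exp (δ * T) * Real.exp (-(c₀ * T / 2)) := by
      rw [← Real.exp_add]
      exact Real.exp_le_exp.2 (by linarith)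
    have e2 : M * (1 / 2) ^ N ≤ η * Real.exp (δ * T) * (2 * Real.exp (-(c₀ * T / 2))) := by
      gcongr
    have e3 : Real.exp (Real.pi * T * ‖w‖ ^ 2) ≤ Real.exp (c₀ * T / 4) := by
      refine Real.exp_le_exp.2 ?_
      calc Real.pi * T * ‖w‖ ^ 2 ≤ Real.pi * T * h ^ 2 := by gcongr
        _ = Real.pi * h ^ 2 * T := by ring
        _ ≤ c₀ / 4 * T := by gcongr
        _ = _ := by ring
    calc _ ≤ (Real.exp (δ * T) * Real.exp (-(c₀ * T / 2)) +
          η * Real.exp (δ * T) * (2 * Real.exp (-(c₀ * T / 2)))) * Real.exp (c₀ * T / 4) := by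
          gcongr
      _ = (1 + 2 * η) * (Real.exp (δ * T) * Real.exp (-(c₀ * T / 2)) * Real.exp (c₀ * T / 4)) := by
          ring
      _ ≤ _ := by
          rw [← Real.exp_add, ← Real.exp_add]
          gcongr
          linarith
  have f3 : Real.exp (-(ρ ^ 2 * T / 16)) ≤ Real.exp (-(4 * (δ * T))) :=
    Real.exp_le_exp.2 (by linarith)
  have f4 : M * Real.exp (-D) ≤ η * Real.exp (-(b * L)) := by
    rw [hM, mul_assoc, ← Real.exp_add]
    gcongr
    linarith
  have f5 : M * (1 / 2) ^ N ≤ 2 * η * Real.exp (-(b * L)) := by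
    calc M * (1 / 2) ^ N ≤ η * Real.exp (δ * T) * (2 * Real.exp (-(c₀ * T / 2))) := by gcongr
      _ = 2 * η * Real.exp (δ * T + -(c₀ * T / 2)) := by rw [Real.exp_add]; ring
      _ ≤ 2 * η * Real.exp (-(δ * T)) := by gcongr; linarith
      _ ≤ _ := by gcongr
  have hE : Real.exp (2 * (δ * T)) * Real.exp (-(3 * (δ * T))) = Real.exp (-(δ * T)) := by
    rw [← Real.exp_add]; ring_nf
  have hE' : Real.exp (2 * (δ * T)) * (Real.exp (δ * T) * Real.exp (-(4 * (δ * T)))) =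
      Real.exp (-(δ * T)) := by rw [← Real.exp_add, ← Real.exp_add]; ring_nf
  have hSle : ∫ u, ‖φ u‖ ≤ Real.exp (δ * T) := hS.trans (Real.exp_le_exp.2 t4)
  calc ‖gaussRegularization D v c s φ w - p.sum w‖
      = ‖(gaussRegularization D v c s φ w - p.partialSum N w) -
          (p.sum w - p.partialSum N w)‖ := by congr 1; abel
    _ ≤ _ := (norm_sub_le _ _).trans (add_le_add key key2)
    _ ≤ Real.exp (2 * (δ * T)) * ((1 + 2 * η) * Real.exp (-(3 * (δ * T))) * V +
          Real.exp (δ * T) * Real.exp (-(4 * (δ * T))) +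
          η * Real.exp (δ * T) * Real.exp (-(4 * (δ * T))) * C₁) +
          4 * (η * Real.exp (-(b * L))) * C₂ + 2 * (2 * η * Real.exp (-(b * L))) := by
        refine add_le_add (add_le_add ?_ ?_) ?_
        · have hS0 : 0 ≤ ∫ u, ‖φ u‖ := integral_nonneg fun u => norm_nonneg _
          gcongr
        · rw [mul_assoc 4 M]
          gcongr
        · rw [mul_assoc 2 M]
          gcongr
    _ = (1 + 2 * η) * V * Real.exp (-(δ * T)) + Real.exp (-(δ * T)) +
          η * C₁ * Real.exp (-(δ * T)) + 4 * η * C₂ * Real.exp (-(b * L)) +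
          4 * η * Real.exp (-(b * L)) := by
        linear_combination (1 + 2 * η) * V * hE + (1 + η * C₁) * hE'
    _ ≤ (1 + 2 * η) * V * Real.exp (-(b * L)) + Real.exp (-(b * L)) +
          η * C₁ * Real.exp (-(b * L)) + 4 * η * C₂ * Real.exp (-(b * L)) +
          4 * η * Real.exp (-(b * L)) := by gcongr
    _ = _ := by ring

end Asymptotics

/-! ### Asymptotics as ε → 0 and diagonal choice. -/

section SmallParameter

/-- The filter `ε → 0` on `(0, 1)`. -/
def smallParam : Filter (Ioo (0 : ℝ) 1) := comap Subtype.val (𝓝 0)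

theorem eventually_smallParam {P : Ioo (0 : ℝ) 1 → Prop} :
    (∀ᶠ ε in smallParam, P ε) ↔ ∃ ε₀ ∈ Ioo (0 : ℝ) 1, ∀ ε : Ioo (0 : ℝ) 1, (ε : ℝ) < ε₀ → P ε := by
  rw [smallParam, Filter.eventually_comap, Metric.eventually_nhds_iff]
  constructor
  · rintro ⟨r, hr, h⟩
    refine ⟨min r (1 / 2), ⟨by positivity, (min_le_right _ _).trans_lt (by norm_num)⟩,
      fun ε hε => h ?_ ε rfl⟩
    rw [Real.dist_eq, sub_zero, abs_of_pos ε.2.1]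
    exact hε.trans_le (min_le_left _ _)
  · rintro ⟨r, hr, h⟩
    refine ⟨r, hr.1, fun {y} hy ε hε => h ε ?_⟩
    rw [Real.dist_eq, sub_zero, ← hε, abs_of_pos ε.2.1] at hy
    exact hy

/-- `log (1 / ε)` -/
noncomputable def logInv (ε : Ioo (0 : ℝ) 1) : ℝ := -Real.log ε

theorem logInv_pos (ε : Ioo (0 : ℝ) 1) : 0 < logInv ε :=
  neg_pos.2 (Real.log_neg ε.2.1 ε.2.2)

theorem rpow_eq_exp_logInv (ε : Ioo (0 : ℝ) 1) (a : ℝ) :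
    (ε : ℝ) ^ a = Real.exp (-(a * logInv ε)) := by
  rw [Real.rpow_def_of_pos ε.2.1, logInv]; ring_nf

theorem eventually_le_logInv (b : ℝ) : ∀ᶠ ε in smallParam, b ≤ logInv ε := by
  rw [eventually_smallParam]
  refine ⟨min (Real.exp (-b)) (1 / 2), ⟨by positivity, (min_le_right _ _).trans_lt (by norm_num)⟩,
    fun ε hε => ?_⟩
  have := Real.log_le_log ε.2.1 (hε.le.trans (min_le_left _ _))
  rw [Real.log_exp] at this
  rw [logInv]; linarith

theorem Net.derivIsBigO_iff {E : Type*} [NormedAddCommGroup E] [NormedSpace ℝ E] {u : Net E}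
    {K : Set E} {n : ℕ} {a : ℝ} : u.DerivIsBigO K n a ↔ ∃ C : ℝ, ∀ᶠ ε in smallParam,
      ∀ x ∈ K, ‖iteratedFDeriv ℝ n (u ε) x‖ ≤ C * Real.exp (-(a * logInv ε)) := by
  simp only [Net.DerivIsBigO, eventually_smallParam, rpow_eq_exp_logInv]

/-- Diagonal choice of an index which tends to infinity as `ε → 0`. -/
theorem exists_tendsto_atTop_eventually {Q : ℕ → Ioo (0 : ℝ) 1 → Prop}
    (hQ : ∀ j, ∀ᶠ ε in smallParam, Q j ε) : ∃ J : Ioo (0 : ℝ) 1 → ℕ,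
      Tendsto J smallParam atTop ∧ ∀ᶠ ε in smallParam, Q (J ε) ε := by
  classical
  -- The greatest index up to which all conditions hold at ε; the cap log (1/ε) makes it finite and
  -- itself tends to infinity.
  let J : Ioo (0 : ℝ) 1 → ℕ := fun ε =>
    Nat.findGreatest (fun j => ∀ i ≤ j, Q i ε) ⌊logInv ε⌋₊
  refine ⟨J, tendsto_atTop.2 fun m => ?_, ?_⟩
  · have h1 : ∀ᶠ ε in smallParam, ∀ i ∈ Finset.range (m + 1), Q i ε :=
      (Filter.eventually_all_finset _).2 fun i _ => hQ i
    filter_upwards [h1, eventually_le_logInv m] with ε hε hm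
    exact Nat.le_findGreatest (Nat.le_floor hm)
      fun i hi => hε i (Finset.mem_range.2 (Nat.lt_succ_of_le hi))
  · filter_upwards [hQ 0] with ε hε
    have : ∀ i ≤ J ε, Q i ε := Nat.findGreatest_spec (P := fun j => ∀ i ≤ j, Q i ε)
      (Nat.zero_le _) fun i hi => by rwa [Nat.le_zero.1 hi]
    exact this _ le_rfl

end SmallParameter

/-! ### Moderateness and nullity are local properties. -/

section Local

variable {E : Type*} [NormedAddCommGroup E] [NormedSpace ℝ E]

theorem Net.DerivIsBigO.mono {u : Net E} {K K' : Set E} {n : ℕ} {a : ℝ}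
    (h : u.DerivIsBigO K n a) (hK : K' ⊆ K) : u.DerivIsBigO K' n a := by
  obtain ⟨C, ε₀, h₀, h⟩ := h
  exact ⟨C, ε₀, h₀, fun ε hε x hx => h ε hε x (hK hx)⟩

theorem Net.DerivIsBigO.union {u : Net E} {K K' : Set E} {n : ℕ} {a b : ℝ}
    (h : u.DerivIsBigO K n a) (h' : u.DerivIsBigO K' n b) :
    u.DerivIsBigO (K ∪ K') n (min a b) := by
  rw [Net.derivIsBigO_iff] at *
  obtain ⟨C, h⟩ := h
  obtain ⟨C', h'⟩ := h'
  refine ⟨|C| + |C'|, ?_⟩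
  filter_upwards [h, h'] with ε hε hε' x hx
  have hL := logInv_pos ε
  rcases hx with hx | hx
  · refine (hε x hx).trans (mul_le_mul ((le_abs_self C).trans (by linarith [abs_nonneg C'])) ?_
      (Real.exp_pos _).le (by positivity))
    gcongr
    exact min_le_left a b
  · refine (hε' x hx).trans (mul_le_mul ((le_abs_self C').trans (by linarith [abs_nonneg C])) ?_
      (Real.exp_pos _).le (by positivity))
    gcongr
    exact min_le_right a b

theorem Net.IsModerateOn.of_local {u : Net E} {ω : Set E} (hs : u.IsSmoothOn ω)
    (h : ∀ n, ∀ x ∈ ω, ∃ t ∈ 𝓝 x, ∃ a, u.DerivIsBigO t n a) : u.IsModerateOn ω := by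
  refine ⟨hs, fun K hK hc n => ?_⟩
  refine hc.induction_on (p := fun t => ∃ a, u.DerivIsBigO t n a) ?_ ?_ ?_ ?_
  · exact ⟨0, 0, 1 / 2, by norm_num, by simp⟩
  · rintro s t hst ⟨a, ha⟩
    exact ⟨a, ha.mono hst⟩
  · rintro s t ⟨a, ha⟩ ⟨b, hb⟩
    exact ⟨_, ha.union hb⟩
  · intro x hx
    obtain ⟨t, ht, ha⟩ := h n x (hK hx)
    exact ⟨t, mem_nhdsWithin_of_mem_nhds ht, ha⟩

theorem Net.IsNullOn.of_local {u : Net E} {ω : Set E} (hs : u.IsSmoothOn ω)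
    (h : ∀ n b, ∀ x ∈ ω, ∃ t ∈ 𝓝 x, u.DerivIsBigO t n b) : u.IsNullOn ω := by
  refine ⟨hs, fun K hK hc n b => ?_⟩
  refine hc.induction_on (p := fun t => u.DerivIsBigO t n b) ?_ ?_ ?_ ?_
  · exact ⟨0, 1 / 2, by norm_num, by simp⟩
  · exact fun s t hst ht => ht.mono hst
  · intro s t hs ht
    have := hs.union ht
    rwa [min_self] at this
  · intro x hx
    obtain ⟨t, ht, ha⟩ := h n b x (hK hx)
    exact ⟨t, mem_nhdsWithin_of_mem_nhds ht, ha⟩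

theorem Net.IsNullOn.isModerateOn {u : Net E} {ω : Set E} (h : u.IsNullOn ω) :
    u.IsModerateOn ω :=
  ⟨h.1, fun K hK hc n => ⟨0, h.2 K hK hc n 0⟩⟩

theorem Net.DerivIsBigO.sub {u v : Net E} {ω K : Set E} (hω : IsOpen ω) (hK : K ⊆ ω)
    (hu : u.IsSmoothOn ω) (hv : v.IsSmoothOn ω) {n : ℕ} {a b : ℝ} (h : u.DerivIsBigO K n a)
    (h' : v.DerivIsBigO K n b) : (u - v).DerivIsBigO K n (min a b) := by
  have h1 := h.union (K' := ∅) (b := b) ⟨0, 1 / 2, by norm_num, by simp⟩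
  have h2 := Net.DerivIsBigO.union (K := ∅) (a := a) ⟨0, 1 / 2, by norm_num, by simp⟩ h'
  rw [union_empty, Net.derivIsBigO_iff] at h1
  rw [empty_union, Net.derivIsBigO_iff] at h2
  rw [Net.derivIsBigO_iff]
  obtain ⟨C, h1⟩ := h1
  obtain ⟨C', h2⟩ := h2
  refine ⟨C + C', ?_⟩
  filter_upwards [h1, h2] with ε hε hε' x hx
  have hs : ∀ {w : Net E}, w.IsSmoothOn ω → ContDiffAt ℝ n (w ε) x := fun hw =>
    ((hw ε).contDiffAt (hω.mem_nhds (hK hx))).of_le (by exact_mod_cast le_top)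
  have : (u - v) ε = u ε - v ε := rfl
  rw [this, iteratedFDeriv_sub_apply (hs hu) (hs hv), add_mul]
  exact (norm_sub_le _ _).trans (add_le_add (hε x hx) (hε' x hx))

theorem Net.IsModerateOn.sub {u v : Net E} {ω : Set E} (hω : IsOpen ω) (hu : u.IsModerateOn ω)
    (hv : v.IsModerateOn ω) : (u - v).IsModerateOn ω := by
  refine ⟨fun ε => (hu.1 ε).sub (hv.1 ε), fun K hK hc n => ?_⟩
  obtain ⟨a, ha⟩ := hu.2 K hK hc n
  obtain ⟨b, hb⟩ := hv.2 K hK hc n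
  exact ⟨_, ha.sub hω hK hu.1 hv.1 hb⟩

end Local

/-! ### From sup bounds on holomorphic nets to bounds on all derivatives. -/

section HolomorphicNets

variable {d : ℕ}

/-- Cauchy's estimates on balls of half the distance to the boundary lose only a constant, so every
derivative keeps the exponent b. -/
theorem exists_derivIsBigO_of_holomorphic {F : Net (EuclideanSpace ℂ (Fin d))}
    {c : EuclideanSpace ℂ (Fin d)} {h b C : ℝ}
    (hd : ∀ᶠ ε in smallParam, DifferentiableOn ℂ (F ε) (ball c h))
    (hF : ∀ᶠ ε in smallParam, ∀ z ∈ ball c h, ‖F ε z‖ ≤ C * Real.exp (-(b * logInv ε))) (n : ℕ)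
    {z₀ : EuclideanSpace ℂ (Fin d)} (hz₀ : z₀ ∈ ball c h) :
    ∃ r > 0, ball z₀ r ⊆ ball c h ∧ F.DerivIsBigO (ball z₀ r) n b := by
  have hr : 0 < (h - dist z₀ c) / 2 := half_pos (sub_pos.2 hz₀)
  set r := (h - dist z₀ c) / 2 with hrdef
  have hsub : ∀ z ∈ ball z₀ r, ball z r ⊆ ball c h := fun z hz y hy => by
    rw [mem_ball] at *
    linarith [dist_triangle y z c, dist_triangle z z₀ c]
  refine ⟨r, hr, fun z hz => hsub z hz (mem_ball_self hr), ?_⟩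
  rw [Net.derivIsBigO_iff]
  refine ⟨(2 ^ (n + 1) / r) ^ n * C, ?_⟩
  filter_upwards [hd, hF] with ε hε hε' z hz
  rw [mul_assoc]
  exact norm_iteratedFDeriv_real_le_of_norm_le n hr (hε.mono (hsub z hz))
    fun y hy => hε' y (hsub z hz hy)

theorem norm_iteratedFDeriv_comp_realToComplex_le {F : EuclideanSpace ℂ (Fin d) → ℂ}
    {U : Set (EuclideanSpace ℂ (Fin d))} (hU : IsOpen U) (hF : DifferentiableOn ℂ F U)
    {x : EuclideanSpace ℝ (Fin d)} (hx : realToComplex x ∈ U) (n : ℕ) :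
    ‖iteratedFDeriv ℝ n (fun x => F (realToComplex x)) x‖ ≤
      ‖iteratedFDeriv ℝ n F (realToComplex x)‖ := by
  set ι := (realToComplexₗᵢ d).toContinuousLinearMap
  have hpre : IsOpen (ι ⁻¹' U) := hU.preimage ι.continuous
  have h := ι.iteratedFDerivWithin_comp_right (hF.contDiffOn_real hU) hU.uniqueDiffOn
    hpre.uniqueDiffOn hx (i := n) (by exact_mod_cast le_top)
  rw [iteratedFDerivWithin_of_isOpen n hpre hx,
    iteratedFDerivWithin_of_isOpen n hU (show ι x ∈ U from hx)] at h
  have h2 : (fun x => F (realToComplex x)) = F ∘ ι := rfl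
  rw [h2, h]
  refine (ContinuousMultilinearMap.norm_compContinuousLinearMap_le _ _).trans ?_
  refine mul_le_of_le_one_right (norm_nonneg _) ?_
  exact Finset.prod_le_one (fun _ _ => norm_nonneg _)
    fun _ _ => (realToComplexₗᵢ d).norm_toContinuousLinearMap_le

end HolomorphicNets

/-! ### Local power series of a real analytic generalized function. -/

section LocalExpansion

variable {d : ℕ}

/-- Near `x`, the net `u` is equivalent to a net `g` with moderate power series `p` at `x`. -/
structure IsLocalExpansion (u : Net (EuclideanSpace ℝ (Fin d)))
    (ω : Set (EuclideanSpace ℝ (Fin d))) (x : EuclideanSpace ℝ (Fin d)) (κ ρ η a : ℝ)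
    (g : Net (EuclideanSpace ℝ (Fin d)))
    (p : Ioo (0 : ℝ) 1 → FormalMultilinearSeries ℂ (EuclideanSpace ℂ (Fin d)) ℂ) : Prop where
  κ_pos : 0 < κ
  ρ_pos : 0 < ρ
  η_pos : 0 < η
  a_pos : 0 < a
  closedBall_subset : closedBall x ρ ⊆ ω
  isNullOn : (u - g).IsNullOn (ball x ρ)
  norm_sub_net_le : ∀ b : ℝ, ∀ᶠ ε in smallParam, ∀ v, ‖v‖ < ρ →
    ‖u ε (x + v) - g ε (x + v)‖ ≤ Real.exp (-(b * logInv ε))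
  norm_series_le : ∀ᶠ ε in smallParam, ∀ n, ‖p ε n‖ ≤ η * Real.exp (a * logInv ε) * κ ^ n
  norm_sub_partialSum_le : ∀ᶠ ε in smallParam, ∀ v, ‖v‖ < ρ → ∀ n,
    ‖g ε (x + v) - (p ε).partialSum (n + 1) (realToComplex v)‖ ≤
      η * Real.exp (a * logInv ε) * (1 / 2) ^ (n + 1)

theorem Net.IsNullOn.eventually_norm_le {E : Type*} [NormedAddCommGroup E] [NormedSpace ℝ E]
    {u : Net E} {ω K : Set E} (h : u.IsNullOn ω) (hK : K ⊆ ω) (hc : IsCompact K) (b : ℝ) :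
    ∀ᶠ ε in smallParam, ∀ x ∈ K, ‖u ε x‖ ≤ Real.exp (-(b * logInv ε)) := by
  -- The spare power of ε absorbs the constant C.
  obtain ⟨C, hC⟩ := Net.derivIsBigO_iff.1 (h.2 K hK hc 0 (b + 1))
  filter_upwards [hC, eventually_le_logInv (Real.log (max C 1))] with ε hε hL x hx
  have h1 := hε x hx
  rw [norm_iteratedFDeriv_zero] at h1
  refine h1.trans ?_
  calc C * Real.exp (-((b + 1) * logInv ε)) ≤
      Real.exp (logInv ε) * Real.exp (-((b + 1) * logInv ε)) := by
        gcongr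
        calc C ≤ max C 1 := le_max_left _ _
          _ = Real.exp (Real.log (max C 1)) := (Real.exp_log (by positivity)).symm
          _ ≤ _ := Real.exp_le_exp.2 hL
    _ = _ := by rw [← Real.exp_add]; ring_nf

theorem Colombeau.RealAnalyticAt.exists_isLocalExpansion
    {ω : TopologicalSpace.Opens (EuclideanSpace ℝ (Fin d))} {u : Net (EuclideanSpace ℝ (Fin d))}
    {hu : u.IsModerateOn (ω : Set (EuclideanSpace ℝ (Fin d)))} {x : EuclideanSpace ℝ (Fin d)}
    (h : (Colombeau.mk u hu).RealAnalyticAt x) :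
    ∃ κ ρ η a g p, IsLocalExpansion u ω x κ ρ η a g p := by
  obtain ⟨r, hr, B, hBr, hB, g, ⟨hg, hfg⟩, η, hη, a, ha, ε₀, hε₀, hbd⟩ := h
  have hnull : (u - g).IsNullOn (ball x r) := by
    have : (colombeauSetoid B).r ⟨u, hu.mono hB⟩ ⟨g, hg⟩ := Quotient.exact hfg
    rw [← hBr]
    exact this
  have hgs : ∀ ε, ContDiffOn ℝ ((⊤ : ℕ∞) : WithTop ℕ∞) (g ε) (ball x r) := fun ε => by
    rw [← hBr]; exact hg.1 ε
  set κ : ℝ := (d + 1) * η with hκ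
  have hκpos : 0 < κ := by positivity
  -- Half of r keeps the closed ball inside; 1/(4κ) makes the Taylor remainder ratio 2κ‖v‖ at most
  -- 1/2.
  set ρ : ℝ := min (r / 2) (1 / (4 * κ)) with hρ
  have hρpos : 0 < ρ := by positivity
  have hρr : ρ < r := (min_le_left _ _).trans_lt (half_lt_self hr)
  have hρκ : 2 * (κ * ρ) ≤ 1 / 2 := by
    have : ρ ≤ 1 / (4 * κ) := min_le_right _ _
    rw [le_div_iff₀ (by positivity)] at this
    linarith
  have hAB : ∀ᶠ ε in smallParam,
      AnalyticBound (g ε) (ball x r) η (Real.exp (a * logInv ε)) := by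
    refine eventually_smallParam.2 ⟨ε₀, hε₀, fun ε hε n i y hy => ?_⟩
    have := hbd ε hε n i y (by rw [← SetLike.mem_coe, hBr]; exact hy)
    rwa [rpow_eq_exp_logInv, neg_mul, neg_neg] at this
  refine ⟨κ, ρ, η, a, g, fun ε => complexTaylorSeries (g ε) x, hκpos, hρpos, hη, ha, ?_,
    hnull.mono (ball_subset_ball hρr.le), fun b => ?_, ?_, ?_⟩
  · refine (closedBall_subset_ball hρr).trans ?_
    rw [← hBr]
    exact hB
  · filter_upwards [hnull.eventually_norm_le (closedBall_subset_ball hρr)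
      (isCompact_closedBall x ρ) b] with ε hε v hv
    exact hε (x + v) (by simpa using hv.le)
  · filter_upwards [hAB] with ε hε n
    exact hε.norm_complexTaylorSeries_le hη (Real.exp_pos _).le (mem_ball_self hr) n
  · filter_upwards [hAB] with ε hε v hv n
    refine (hε.norm_sub_partialSum_le hη (Real.exp_pos _).le (hgs ε) (hv.trans hρr) n).trans ?_
    have : 2 * ((d + 1) * η * ‖v‖) ≤ 1 / 2 :=
      le_trans (mul_le_mul_of_nonneg_left (mul_le_mul_of_nonneg_left hv.le hκpos.le)
        two_pos.le) hρκ
    gcongr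

variable {u : Net (EuclideanSpace ℝ (Fin d))} {ω : Set (EuclideanSpace ℝ (Fin d))}
  {x : EuclideanSpace ℝ (Fin d)} {κ ρ η a : ℝ} {g : Net (EuclideanSpace ℝ (Fin d))}
  {p : Ioo (0 : ℝ) 1 → FormalMultilinearSeries ℂ (EuclideanSpace ℂ (Fin d)) ℂ}

/-- The same partial sums converge to both sides; ε is fixed while n tends to infinity. -/
theorem IsLocalExpansion.eventually_eq_sum (H : IsLocalExpansion u ω x κ ρ η a g p) :
    ∀ᶠ ε in smallParam, ∀ v, ‖v‖ < ρ → κ * ‖v‖ ≤ 1 / 2 →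
      g ε (x + v) = (p ε).sum (realToComplex v) := by
  filter_upwards [H.norm_series_le, H.norm_sub_partialSum_le] with ε hp hg v hv hκv
  have hη := H.η_pos
  have hM : 0 ≤ η * Real.exp (a * logInv ε) := by positivity
  rw [← sub_eq_zero, ← norm_le_zero_iff]
  have ht : Tendsto (fun n : ℕ => 3 * (η * Real.exp (a * logInv ε)) * (1 / 2 : ℝ) ^ (n + 1)) atTop
      (𝓝 (3 * (η * Real.exp (a * logInv ε)) * 0)) :=
    ((tendsto_add_atTop_iff_nat 1).2 (tendsto_pow_atTop_nhds_zero_of_lt_one (by norm_num)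
      (by norm_num))).const_mul _
  rw [mul_zero] at ht
  refine ge_of_tendsto' ht fun n => ?_
  have h1 := hg v hv n
  have h2 := norm_sum_sub_partialSum_le hM hp H.κ_pos (w := realToComplex v)
    (by rwa [norm_realToComplex]) (n + 1)
  calc _ = ‖(g ε (x + v) - (p ε).partialSum (n + 1) (realToComplex v)) -
        ((p ε).sum (realToComplex v) - (p ε).partialSum (n + 1) (realToComplex v))‖ := by
        congr 1; abel
    _ ≤ _ := (norm_sub_le _ _).trans (add_le_add h1 h2)
    _ = _ := by ring

theorem IsLocalExpansion.eventually_differentiableOn (H : IsLocalExpansion u ω x κ ρ η a g p)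
    {h : ℝ} (hh : κ * h ≤ 1 / 2) : ∀ᶠ ε in smallParam, DifferentiableOn ℂ
      (fun z => (p ε).sum (z - realToComplex x)) (ball (realToComplex x) h) := by
  filter_upwards [H.norm_series_le] with ε hp
  have hη := H.η_pos
  have hκ := H.κ_pos
  refine (differentiableOn_sum hκ hp).comp (Differentiable.differentiableOn (by fun_prop))
    fun z hz => ?_
  rw [mem_ball, dist_eq_norm] at hz
  rw [mem_ball_zero_iff, ← one_div, lt_div_iff₀ hκ]
  nlinarith

/-- A holomorphic net which is close to the power series is moderate, and its restriction to the
real domain is equivalent to `u`. -/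
theorem IsLocalExpansion.derivIsBigO (H : IsLocalExpansion u ω x κ ρ η a g p) {h : ℝ}
    (hhρ : h ≤ ρ) (hh : κ * h ≤ 1 / 2) {F : Net (EuclideanSpace ℂ (Fin d))}
    (hF : ∀ ε, Differentiable ℂ (F ε))
    (hFp : ∀ b : ℝ, ∃ C, ∀ᶠ ε in smallParam, ∀ w, ‖w‖ ≤ h →
      ‖F ε (realToComplex x + w) - (p ε).sum w‖ ≤ C * Real.exp (-(b * logInv ε))) (n : ℕ) :
    (∀ z ∈ ball (realToComplex x) h, ∃ t ∈ 𝓝 z, ∃ a, F.DerivIsBigO t n a) ∧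
    ∀ b, ∀ y ∈ ball x h, ∃ t ∈ 𝓝 y,
      Net.DerivIsBigO (u - fun ε y => F ε (realToComplex y)) t n b := by
  have hη := H.η_pos
  have hκ := H.κ_pos
  have hFp' : ∀ b : ℝ, ∃ C, ∀ᶠ ε in smallParam, ∀ z ∈ ball (realToComplex x) h,
      ‖F ε z - (p ε).sum (z - realToComplex x)‖ ≤ C * Real.exp (-(b * logInv ε)) := fun b => by
    obtain ⟨C, hC⟩ := hFp b
    refine ⟨C, ?_⟩
    filter_upwards [hC] with ε hε z hz
    have := hε (z - realToComplex x) (by rw [← dist_eq_norm]; exact (mem_ball.1 hz).le)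
    rwa [add_sub_cancel] at this
  constructor
  · intro z hz
    obtain ⟨C, hC⟩ := hFp' (-a)
    have hle : ∀ᶠ ε in smallParam, ∀ z ∈ ball (realToComplex x) h,
        ‖F ε z‖ ≤ (C + 2 * η) * Real.exp (-(-a * logInv ε)) := by
      filter_upwards [hC, H.norm_series_le] with ε hε hp z hz
      have h1 : κ * ‖z - realToComplex x‖ ≤ 1 / 2 := by
        rw [mem_ball, dist_eq_norm] at hz
        exact (mul_le_mul_of_nonneg_left hz.le hκ.le).trans hh
      -- The empty partial sum turns the tail estimate into a bound for the sum itself.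
      have h2 := norm_sum_sub_partialSum_le (by positivity) hp hκ h1 0
      simp only [FormalMultilinearSeries.partialSum, Finset.range_zero, Finset.sum_empty, sub_zero,
        pow_zero, mul_one] at h2
      calc ‖F ε z‖ = ‖(F ε z - (p ε).sum (z - realToComplex x)) +
            (p ε).sum (z - realToComplex x)‖ := by simp
        _ ≤ _ := (norm_add_le _ _).trans (add_le_add (hε z hz) h2)
        _ = _ := by rw [neg_mul, neg_neg]; ring
    obtain ⟨r, hr, -, hbig⟩ := exists_derivIsBigO_of_holomorphic
      (Eventually.of_forall fun ε => (hF ε).differentiableOn) hle n hz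
    exact ⟨_, ball_mem_nhds z hr, _, hbig⟩
  · intro b y hy
    obtain ⟨C, hC⟩ := hFp' b
    -- On the real ball `g` equals the sum of its series, so u - F is the null net u - g minus the
    -- restriction of `Gd`, which Cauchy's estimates control.
    let Gd : Net (EuclideanSpace ℂ (Fin d)) := fun ε z =>
      F ε z - (p ε).sum (z - realToComplex x)
    have hGd : ∀ᶠ ε in smallParam, DifferentiableOn ℂ (Gd ε) (ball (realToComplex x) h) := by
      filter_upwards [H.eventually_differentiableOn hh] with ε hε
      exact (hF ε).differentiableOn.sub hε
    have hyb : ∀ y, realToComplex y ∈ ball (realToComplex x) h ↔ y ∈ ball x h := fun y => by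
      rw [mem_ball, mem_ball, dist_eq_norm, dist_eq_norm, ← realToComplex_sub, norm_realToComplex]
    obtain ⟨r, hr, hrsub, hbig⟩ := exists_derivIsBigO_of_holomorphic (F := Gd) hGd hC n
      ((hyb y).2 hy)
    obtain ⟨s, hs, hssub⟩ : ∃ s > 0, closedBall y s ⊆ ball x h ∩ ball y r :=
      Metric.nhds_basis_closedBall.mem_iff.1
        (inter_mem (isOpen_ball.mem_nhds hy) (ball_mem_nhds y hr))
    obtain ⟨C₁, h₁⟩ := Net.derivIsBigO_iff.1 hbig
    obtain ⟨C₂, h₂⟩ := Net.derivIsBigO_iff.1 (H.isNullOn.2 (closedBall y s)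
      ((hssub.trans inter_subset_left).trans (ball_subset_ball hhρ)) (isCompact_closedBall y s) n b)
    refine ⟨closedBall y s, closedBall_mem_nhds y hs, Net.derivIsBigO_iff.2 ⟨C₂ + C₁, ?_⟩⟩
    filter_upwards [h₁, h₂, hGd, H.eventually_eq_sum] with ε hε₁ hε₂ hdiff heq q hq
    have hqx := (hssub hq).1
    have hqr : realToComplex q ∈ ball (realToComplex y) r := by
      have := (hssub hq).2
      rwa [mem_ball, dist_eq_norm, ← norm_realToComplex, realToComplex_sub, ← dist_eq_norm] at this
    have hloc : (u - fun ε y => F ε (realToComplex y)) ε =ᶠ[𝓝 q]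
        ((u - g) ε - fun y => Gd ε (realToComplex y)) := by
      filter_upwards [isOpen_ball.mem_nhds hqx] with q' hq'
      rw [mem_ball, dist_eq_norm] at hq'
      have := heq (q' - x) (hq'.trans_le hhρ)
        ((mul_le_mul_of_nonneg_left hq'.le hκ.le).trans hh)
      rw [add_sub_cancel, realToComplex_sub] at this
      simp only [Pi.sub_apply, Gd, this]
      ring
    rw [(hloc.iteratedFDeriv ℝ n).eq_of_nhds, iteratedFDeriv_sub_apply, add_mul]
    · exact (norm_sub_le _ _).trans (add_le_add (hε₂ q hq)
        ((norm_iteratedFDeriv_comp_realToComplex_le isOpen_ball hdiff ((hyb q).2 hqx) n).trans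
          (hε₁ _ hqr)))
    · exact (((H.isNullOn.1 ε).contDiffAt (isOpen_ball.mem_nhds (ball_subset_ball hhρ hqx)))).of_le
        (by exact_mod_cast le_top)
    · have h5 : ContDiffAt ℝ ((⊤ : ℕ∞) : WithTop ℕ∞) (Gd ε) (realToComplex q) :=
        (hdiff.contDiffOn_real isOpen_ball).contDiffAt (isOpen_ball.mem_nhds ((hyb q).2 hqx))
      exact (h5.comp q (realToComplexₗᵢ d).contDiff.contDiffAt).of_le (by exact_mod_cast le_top)

end LocalExpansion

/-! ### Construction of the global entire representative. -/

section Extension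

variable {d : ℕ}

/-- Translation by x reduces this to the estimate at 0. The radius is fixed before the weights, A
and the cut-off sets, so one net can serve all points x. -/
theorem IsLocalExpansion.exists_norm_gaussRegularization_sub_le
    {u : Net (EuclideanSpace ℝ (Fin d))} {ω : Set (EuclideanSpace ℝ (Fin d))}
    {x : EuclideanSpace ℝ (Fin d)} {κ ρ η a : ℝ} {g : Net (EuclideanSpace ℝ (Fin d))}
    {p : Ioo (0 : ℝ) 1 → FormalMultilinearSeries ℂ (EuclideanSpace ℂ (Fin d)) ℂ}
    (H : IsLocalExpansion u ω x κ ρ η a g p) : ∃ h : ℝ, 0 < h ∧ h ≤ ρ ∧ κ * h ≤ 1 / 2 ∧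
      ∀ (v c : ℕ → ℕ → ℝ), (∀ D, IsExtrapolation D (v D) (c D)) →
      ∀ (A : Ioo (0 : ℝ) 1 → ℝ), Tendsto A smallParam atTop →
      ∀ (K : Ioo (0 : ℝ) 1 → Set (EuclideanSpace ℝ (Fin d))),
      (∀ ε, MeasurableSet (K ε)) → (∀ ε, IntegrableOn (u ε) (K ε)) →
      (∀ᶠ ε in smallParam, closedBall x ρ ⊆ K ε) →
      (∀ᶠ ε in smallParam, ∫ y in K ε, ‖u ε y‖ ≤ Real.exp (A ε * logInv ε)) →
      (∀ᶠ ε in smallParam, ∀ w, ‖w‖ < ρ →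
        ‖u ε (x + w) - g ε (x + w)‖ ≤ Real.exp (-(A ε ^ 3 * logInv ε))) →
      ∀ b : ℝ, ∃ C, ∀ᶠ ε in smallParam, ∀ w, ‖w‖ ≤ h →
        ‖gaussRegularization ⌈A ε * logInv ε⌉₊ (v ⌈A ε * logInv ε⌉₊) (c ⌈A ε * logInv ε⌉₊)
          (A ε * √(logInv ε))⁻¹ ((K ε).indicator (u ε)) (realToComplex x + w) - (p ε).sum w‖ ≤
        C * Real.exp (-(b * logInv ε)) := by
  obtain ⟨h, h0, hρ, hκ, hmain⟩ :=
    exists_norm_gaussRegularization_sub_sum_le d H.κ_pos H.ρ_pos H.η_pos H.a_pos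
  refine ⟨h, h0, hρ, hκ, fun v c hvc A hA K hKm hKi hK hint hnear b => ?_⟩
  obtain ⟨R, C, hRC⟩ := hmain b
  refine ⟨C, ?_⟩
  filter_upwards [hA.eventually_ge_atTop R, hA.eventually_ge_atTop 0, eventually_le_logInv 1, hK,
    hint, hnear, H.norm_series_le, H.norm_sub_partialSum_le] with
    ε hAR hA0 hL hKε hintε hnearε hp hg w hw
  have hind : Integrable ((K ε).indicator (u ε)) := (integrable_indicator_iff (hKm ε)).2 (hKi ε)
  rw [gaussRegularization_translate _ _ _ _ _ x, add_sub_cancel_left]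
  refine hRC (A ε) (logInv ε) hAR hL _ _ _ (hvc _) (Nat.le_ceil _)
    (Nat.ceil_lt_add_one (mul_nonneg hA0 (by linarith))).le (p ε) _ (fun y => g ε (x + y)) hp
    (hind.comp_add_left x) ?_ (fun y hy => ?_) hg w hw
  · rw [integral_add_left_eq_self (fun y => ‖(K ε).indicator (u ε) y‖) x]
    simp only [norm_indicator_eq_indicator_norm]
    rwa [integral_indicator (hKm ε)]
  · rw [indicator_of_mem (hKε (by simpa using hy.le))]
    exact hnearε y hy

/-- Every real analytic generalized function has a representative which consists of restrictions
of entire functions that form a moderate net in a complex neighbourhood of the domain. -/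
theorem Colombeau.IsRealAnalytic.exists_entire_representative
    {ω : TopologicalSpace.Opens (EuclideanSpace ℝ (Fin d))} {f : Colombeau ω}
    (hf : f.IsRealAnalytic) : ∃ Ω : Set (EuclideanSpace ℂ (Fin d)), IsOpen Ω ∧
      Ω ∩ Set.range realToComplex = realToComplex '' (ω : Set (EuclideanSpace ℝ (Fin d))) ∧
      ∃ F : Net (EuclideanSpace ℂ (Fin d)), F.IsModerateOn Ω ∧ (∀ ε, Differentiable ℂ (F ε)) ∧
        f.IsRepresentative (fun ε x => F ε (realToComplex x)) := by
  obtain ⟨⟨u, hu⟩, rfl⟩ := Quotient.exists_rep f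
  change (Colombeau.mk u hu).IsRealAnalytic at hf
  have hex := fun x hx => (hf x hx).exists_isLocalExpansion
  choose! κ ρ η a g p H using hex
  have hex2 := fun x hx => (H x hx).exists_norm_gaussRegularization_sub_le
  choose! h h0 hρ hκ hmain using hex2
  choose v c hv1 hv2 hv3 hv4 using exists_extrapolation
  have hvc : ∀ D, IsExtrapolation D (v D) (c D) := fun D => ⟨hv1 D, hv2 D, hv3 D, hv4 D⟩
  -- a countable subcover, with finite pieces `S j`
  obtain ⟨T, hTω, hTc, hTU⟩ := TopologicalSpace.isOpen_biUnion_countable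
    (ω : Set (EuclideanSpace ℝ (Fin d))) (fun x => ball x (h x)) fun _ _ => isOpen_ball
  obtain ⟨code, hcode⟩ := Set.countable_iff_exists_injOn.1 hTc
  let S : ℕ → Set (EuclideanSpace ℝ (Fin d)) := fun j => T ∩ {x | code x ≤ j}
  have hSfin : ∀ j, (S j).Finite := fun j =>
    Set.Finite.of_finite_image ((Set.finite_Iic j).subset (by rintro _ ⟨x, hx, rfl⟩; exact hx.2))
      (hcode.mono inter_subset_left)
  have hSω : ∀ j, ∀ x ∈ S j, x ∈ ω := fun j x hx => hTω hx.1
  let K : ℕ → Set (EuclideanSpace ℝ (Fin d)) := fun j => ⋃ x ∈ S j, closedBall x (ρ x)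
  have hKc : ∀ j, IsCompact (K j) := fun j =>
    (hSfin j).isCompact_biUnion fun x _ => isCompact_closedBall x _
  have hKω : ∀ j, K j ⊆ ω := fun j =>
    iUnion₂_subset fun x hx => (H x (hSω j x hx)).closedBall_subset
  have hKi : ∀ j ε, IntegrableOn (u ε) (K j) := fun j ε =>
    ((hu.1 ε).continuousOn.mono (hKω j)).integrableOn_compact (hKc j)
  -- A must tend to infinity with j and also dominate the moderate growth of the integral over the
  -- j-th compact set.
  have hA : ∀ j : ℕ, ∃ A : ℝ, (j : ℝ) ≤ A ∧
      ∀ᶠ ε in smallParam, ∫ y in K j, ‖u ε y‖ ≤ Real.exp (A * logInv ε) := by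
    intro j
    obtain ⟨e, he⟩ := hu.2 (K j) (hKω j) (hKc j) 0
    obtain ⟨C, hC⟩ := Net.derivIsBigO_iff.1 he
    set V := volume.real (K j)
    refine ⟨max j (1 - e), le_max_left _ _, ?_⟩
    filter_upwards [hC, eventually_le_logInv (|C| * V)] with ε hε hL
    have hlog := logInv_pos ε
    have h1 : ∀ y ∈ K j, ‖(‖u ε y‖)‖ ≤ C * Real.exp (-(e * logInv ε)) := fun y hy => by
      have := hε y hy
      rwa [norm_iteratedFDeriv_zero, ← norm_norm] at this
    have h2 := norm_setIntegral_le_of_norm_le_const (μ := volume) (hKc j).measure_lt_top h1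
    refine ((le_abs_self _).trans h2).trans ?_
    calc C * Real.exp (-(e * logInv ε)) * V ≤ |C| * V * Real.exp (-(e * logInv ε)) := by
          rw [mul_right_comm]
          gcongr
          exact le_abs_self C
      _ ≤ Real.exp (logInv ε) * Real.exp (-(e * logInv ε)) := by
          gcongr
          linarith [Real.add_one_le_exp (logInv ε)]
      _ = Real.exp ((1 - e) * logInv ε) := by rw [← Real.exp_add]; ring_nf
      _ ≤ _ := by gcongr; exact le_max_right _ _
  choose A hjA hAint using hA
  -- For fixed j both conditions hold for small ε, by moderateness on `K j` and by nullity at the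
  -- finitely many centres in `S j`.
  obtain ⟨J, hJ, hQ⟩ := exists_tendsto_atTop_eventually
    (Q := fun j ε => (∫ y in K j, ‖u ε y‖ ≤ Real.exp (A j * logInv ε)) ∧ ∀ x ∈ S j, ∀ w,
      ‖w‖ < ρ x → ‖u ε (x + w) - g x ε (x + w)‖ ≤ Real.exp (-(A j ^ 3 * logInv ε)))
    fun j => (hAint j).and ((Filter.eventually_all_finite (hSfin j)).2 fun x hx =>
      (H x (hSω j x hx)).norm_sub_net_le _)
  have hAJ : Tendsto (fun ε => A (J ε)) smallParam atTop :=
    tendsto_atTop_mono (fun ε => hjA (J ε)) (tendsto_natCast_atTop_atTop.comp hJ)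
  let D : Ioo (0 : ℝ) 1 → ℕ := fun ε => ⌈A (J ε) * logInv ε⌉₊
  -- for large `ε`, where `A (J ε)` may vanish, the net is set to `0`
  let F : Net (EuclideanSpace ℂ (Fin d)) := fun ε => if 0 < A (J ε) then
    gaussRegularization (D ε) (v (D ε)) (c (D ε)) (A (J ε) * √(logInv ε))⁻¹
      ((K (J ε)).indicator (u ε)) else 0
  have hFd : ∀ ε, Differentiable ℂ (F ε) := fun ε => by
    simp only [F]
    split_ifs with hpos
    · have := logInv_pos ε
      exact differentiable_gaussRegularization (hvc _) (by positivity)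
        ((integrable_indicator_iff (hKc _).measurableSet).2 (hKi _ ε))
    · exact differentiable_const _
  have hFp : ∀ x ∈ T, ∀ b : ℝ, ∃ C, ∀ᶠ ε in smallParam, ∀ w, ‖w‖ ≤ h x →
      ‖F ε (realToComplex x + w) - (p x ε).sum w‖ ≤ C * Real.exp (-(b * logInv ε)) := by
    intro x hx b
    -- Each fixed centre is eventually among those treated, so the local estimate holds at it for
    -- every b.
    have hxS : ∀ᶠ ε in smallParam, x ∈ S (J ε) := by
      filter_upwards [hJ.eventually_ge_atTop (code x)] with ε hε using ⟨hx, hε⟩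
    obtain ⟨C, hC⟩ := hmain x (hTω hx) v c hvc (fun ε => A (J ε)) hAJ (fun ε => K (J ε))
      (fun ε => (hKc _).measurableSet) (fun ε => hKi _ ε)
      (hxS.mono fun ε hε => subset_biUnion_of_mem (u := fun x => closedBall x (ρ x)) hε)
      (hQ.mono fun ε hε => hε.1)
      (by filter_upwards [hQ, hxS] with ε hε hxε using hε.2 x hxε) b
    refine ⟨C, ?_⟩
    filter_upwards [hC, hAJ.eventually_gt_atTop 0] with ε hε hpos
    simp only [F, if_pos hpos]
    exact hε
  have hball : ∀ x y : EuclideanSpace ℝ (Fin d),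
      realToComplex y ∈ ball (realToComplex x) (h x) ↔ y ∈ ball x (h x) := fun x y => by
    rw [mem_ball, mem_ball, dist_eq_norm, dist_eq_norm, ← realToComplex_sub, norm_realToComplex]
  have hcover : ∀ y ∈ ω, ∃ x ∈ T, y ∈ ball x (h x) := fun y hy => by
    have : y ∈ ⋃ x ∈ (ω : Set (EuclideanSpace ℝ (Fin d))), ball x (h x) :=
      mem_biUnion hy (mem_ball_self (h0 y hy))
    rw [← hTU] at this
    simpa using this
  have hloc := fun x (hx : x ∈ T) n => (H x (hTω hx)).derivIsBigO (hρ x (hTω hx))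
    (hκ x (hTω hx)) hFd (hFp x hx) n
  have hΩ : IsOpen (⋃ x ∈ T, ball (realToComplex x) (h x)) :=
    isOpen_biUnion fun _ _ => isOpen_ball
  have hnull : (u - fun ε x => F ε (realToComplex x)).IsNullOn
      (ω : Set (EuclideanSpace ℝ (Fin d))) := by
    refine Net.IsNullOn.of_local (fun ε => (hu.1 ε).sub ?_) fun n b y hy => ?_
    · exact (((hFd ε).differentiableOn.contDiffOn_real isOpen_univ).comp
        (realToComplexₗᵢ d).contDiff.contDiffOn (mapsTo_univ _ _) :)
    · obtain ⟨x, hx, hyx⟩ := hcover y hy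
      exact (hloc x hx n).2 b y hyx
  have hmod : Net.IsModerateOn (ω : Set (EuclideanSpace ℝ (Fin d)))
      (fun ε x => F ε (realToComplex x)) := by
    have := hu.sub ω.isOpen hnull.isModerateOn
    rwa [sub_sub_cancel] at this
  refine ⟨⋃ x ∈ T, ball (realToComplex x) (h x), hΩ, ?_, F, ?_, hFd, hmod, ?_⟩
  · ext z
    constructor
    · rintro ⟨hz, y, rfl⟩
      obtain ⟨x, hx, hyx⟩ := mem_iUnion₂.1 hz
      refine ⟨y, (H x (hTω hx)).closedBall_subset ?_, rfl⟩
      exact ball_subset_closedBall (ball_subset_ball (hρ x (hTω hx)) ((hball x y).1 hyx))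
    · rintro ⟨y, hy, rfl⟩
      obtain ⟨x, hx, hyx⟩ := hcover y hy
      exact ⟨mem_biUnion hx ((hball x y).2 hyx), y, rfl⟩
  · refine Net.IsModerateOn.of_local
      (fun ε => (hFd ε).differentiableOn.contDiffOn_real hΩ) fun n z hz => ?_
    obtain ⟨x, hx, hzx⟩ := mem_iUnion₂.1 hz
    exact (hloc x hx n).1 z hzx
  · exact Quotient.sound hnull

end Extension

/-! ### The two parts of the corollary. -/

theorem corollary1 :
    -- (a) local holomorphic extension of a representative, in every dimension
    (∀ (d : ℕ) (ω : TopologicalSpace.Opens (EuclideanSpace ℝ (Fin d))) (f : Colombeau ω),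
      f.IsRealAnalytic →
      ∀ (ω₁ : TopologicalSpace.Opens (EuclideanSpace ℝ (Fin d))) (hω₁ : ω₁ ≤ ω),
        IsCompact (closure (ω₁ : Set (EuclideanSpace ℝ (Fin d)))) →
        closure (ω₁ : Set (EuclideanSpace ℝ (Fin d))) ⊆ ω →
        ∃ Ω₁ : Set (EuclideanSpace ℂ (Fin d)), IsOpen Ω₁ ∧
          Ω₁ ∩ Set.range realToComplex = realToComplex '' (ω₁ : Set (EuclideanSpace ℝ (Fin d))) ∧
          ∃ F : Net (EuclideanSpace ℂ (Fin d)),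
            F.IsModerateOn Ω₁ ∧ (∀ ε, DifferentiableOn ℂ (F ε) Ω₁) ∧
            (f.restrict hω₁).IsRepresentative (fun ε x => F ε (realToComplex x))) ∧
    -- (b) global holomorphic extension of a representative, for d = 1
    (∀ (ω : TopologicalSpace.Opens (EuclideanSpace ℝ (Fin 1))) (f : Colombeau ω),
      f.IsRealAnalytic →
        ∃ Ω : Set (EuclideanSpace ℂ (Fin 1)), IsOpen Ω ∧
          Ω ∩ Set.range realToComplex = realToComplex '' (ω : Set (EuclideanSpace ℝ (Fin 1))) ∧
          ∃ F : Net (EuclideanSpace ℂ (Fin 1)),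
            F.IsModerateOn Ω ∧ (∀ ε, DifferentiableOn ℂ (F ε) Ω) ∧
            f.IsRepresentative (fun ε x => F ε (realToComplex x))) := by
  refine ⟨fun d ω f hf ω₁ hω₁ _ _ => ?_, fun ω f hf => ?_⟩
  · obtain ⟨Ω, hΩ, hΩω, F, hF, hFd, hmod, rfl⟩ := hf.exists_entire_representative
    -- Intersecting Ω with the tube over ω₁ trims its real part from ω to ω₁.
    let re : EuclideanSpace ℂ (Fin d) → EuclideanSpace ℝ (Fin d) :=
      fun z => WithLp.toLp 2 fun j => (z j).re
    have hre : Continuous re := by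
      refine (PiLp.continuous_toLp 2 _).comp (continuous_pi fun j => ?_)
      exact Complex.continuous_re.comp (EuclideanSpace.proj (𝕜 := ℂ) j).continuous
    have hre' : ∀ x, re (realToComplex x) = x := fun x => rfl
    refine ⟨Ω ∩ re ⁻¹' ω₁, hΩ.inter (ω₁.isOpen.preimage hre), ?_, F, hF.mono inter_subset_left,
      fun ε => (hFd ε).differentiableOn, hmod.mono hω₁, rfl⟩
    ext z
    constructor
    · rintro ⟨⟨-, hz⟩, y, rfl⟩
      exact ⟨y, hz, rfl⟩
    · rintro ⟨y, hy, rfl⟩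
      have : realToComplex y ∈ Ω ∩ Set.range realToComplex := by
        rw [hΩω]; exact ⟨y, hω₁ hy, rfl⟩
      exact ⟨⟨this.1, hy⟩, y, rfl⟩
  · obtain ⟨Ω, hΩ, hΩω, F, hF, hFd, hrep⟩ := hf.exists_entire_representative
    exact ⟨Ω, hΩ, hΩω, F, hF, fun ε => (hFd ε).differentiableOn, hrep⟩
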